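/- **Setting.** Let $(X,\mathsf d,\mathfrak m)$ be a metric measure space: $(X,\mathsf d)$ is a complete separable metric space and $\mathfrak m$ a $\sigma$-finite Borel measure. The slope of $f:X\to\mathbb R$ is $|Df|(x)=\limsup_{y\to x}|f(y)-f(x)|/\mathsf d(y,x)$ ($0$ at isolated points). A function $G\in L^2(\mathfrak m)$ is a relaxed gradient of $f$ if there are Lipschitz $f_n\in L^2(\mathfrak m)$ with $f_n\to f$ in $L^2$ and $|Df_n|\rightharpoonup G'$ weakly in $L^2$ for some $G'\le G$ a.e.; $2\,\mathsf{Ch}(f)$ is the minimum of $\int G^2\,d\mathfrak m$ over all relaxed gradients ($+\infty$ if there is none), and $\|f\|_{W^{1,2}}^2=\|f\|_{L^2}^2+2\,\mathsf{Ch}(f)$. A Borel set $E\subset X$ is *polar* if it has zero 2-capacity: $$\inf\{\|u\|_{W^{1,2}} : u \text{ Lipschitz},\ 0\le u\le 1,\ u=1\text{ on a neighbourhood of }E\}=0 .$$ Let $0\le p\le 7$ and $0\le d\le p+1$ be integers. $(X,\mathsf d,\mathfrak m)$ is an *asymptotically D$p$-brane metric measure space* if there are a smooth weighted Riemannian manifold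 $(R,g,e^f d\mathrm{vol}_g)$ of dimension $10-d$ ($f$ smooth, $R$ not necessarily complete) with finitely many pairwise disjoint ends, and an open embedding of $R$ onto a dense subset of $X$, such that $\mathsf d$ restricts to the Riemannian distance of $g$ on $R$ and $\mathfrak m$ is the image of $e^f d\mathrm{vol}_g$ (so $\mathfrak m(X\setminus R)=0$), with the following properties. * Each end is an open subset of $R$ with a diffeomorphism from $M\times\{y\in\mathbb R^{9-p}:0<|y|<\varepsilon\}$, where $(M,h)$ is a smooth Riemannian manifold of dimension $p+1-d$ (the parallel Riemannian factor, $h=dx^2_{p+1-d}$). Put $r=|y|$, so that $|dy|^2=dr^2+r^2ds^2_{\mathbb S^{8-p}}$. The set $\{0<r\le\delta\}$ is closed in $R$ for every $0<\delta<\varepsilon$. * As $r\to0$, uniformly on the end, $g$ is asymptotic to $h+H(r)\left(dr^2+r^2ds^2_{\mathbb S^{8-p}}\right)$, i.e. for every $\eta>0$ the quadratic form of the difference is at most $\eta$ times that of the model for all small $r$; and $e^f\sim H(r)^{(p-7)/2}$ uniformly. Here, for some constants $r_0,g_s>0$, $$H(r)=(r_0/r)^{7-p}\ \ (p<7),\qquad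 H(r)=-\tfrac{2\pi}{g_s}\log(r/r_0)\ \ (p=7).$$ * For every $\delta>0$ the set of tips $X\setminus R$ together with the regions $\{0<r<\delta\}$ of all the ends is open in $X$. **Proposition.** Let $(X,\mathsf d,\mathfrak m)$ be an asymptotically D$p$-brane metric measure space; if $p\in\{6,7\}$, assume also that for each end the Riemannian factor $(M,h)$ has finite volume. Let $\mathcal S$ be the minimal closed singular set, i.e. the intersection of all closed sets $S\subset X$ such that $X\setminus S$, with the restricted distance and measure, is isomorphic (by a measure-preserving isometry) to an open subset of a smooth weighted Riemannian manifold. Then $\mathcal S$ is polar. -/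

import Mathlib

open MeasureTheory Filter Topology Set Manifold Bundle
open scoped ENNReal ContDiff

universe u

noncomputable section

/-! ## Slope, Cheeger energy, Sobolev norm and capacity on a metric measure space -/

section MetricMeasure

variable {X : Type u} [MetricSpace X]

/-- The slope `|Df|(x) = limsup_{y → x, y ≠ x} |f y - f x| / d(y, x)`. At an isolated point the
filter `𝓝[≠] x` is trivial and the value is `0`. It is finite if `f` is Lipschitz. -/
def metricSlope (f : X → ℝ) (x : X) : ℝ≥0∞ :=
  limsup (fun y => edist (f y) (f x) / edist y x) (𝓝[≠] x)

variable [MeasurableSpace X]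

/-- `G ∈ L²` is a relaxed gradient of `f` if there are Lipschitz functions `fₙ ∈ L²` and `G' ∈ L²`
with `fₙ → f` in `L²`, `|Dfₙ| ⇀ G'` weakly in `L²` and `G' ≤ G` a.e. -/
def IsRelaxedGradient (m : Measure X) (f G : X → ℝ) : Prop :=
  MemLp G 2 m ∧
  ∃ (fn : ℕ → X → ℝ) (G' : X → ℝ),
    (∀ n, ∃ K, LipschitzWith K (fn n)) ∧
    (∀ n, MemLp (fn n) 2 m) ∧
    (∀ n, MemLp (fun x => (metricSlope (fn n) x).toReal) 2 m) ∧
    Tendsto (fun n => eLpNorm (fun x => fn n x - f x) 2 m) atTop (𝓝 0) ∧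
    MemLp G' 2 m ∧
    (∀ h : X → ℝ, MemLp h 2 m →
      Tendsto (fun n => ∫ x, (metricSlope (fn n) x).toReal * h x ∂m) atTop
        (𝓝 (∫ x, G' x * h x ∂m))) ∧
    G' ≤ᵐ[m] G

/-- The Cheeger energy `½ ∫ |Df|_*² dm`, where `|Df|_*` is the relaxed gradient of minimal
`L²`-norm; it is `∞` if `f` has no relaxed gradient. -/
def cheegerEnergy (m : Measure X) (f : X → ℝ) : ℝ≥0∞ :=
  2⁻¹ * ⨅ (G : X → ℝ) (_ : IsRelaxedGradient m f G), ∫⁻ x, ‖G x‖ₑ ^ 2 ∂m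

/-- The norm `(‖f‖²_{L²} + 2 Ch(f))^{1/2}`, with value `∞` outside `W^{1,2}`. -/
def sobolevNorm (m : Measure X) (f : X → ℝ) : ℝ≥0∞ :=
  (eLpNorm f 2 m ^ 2 + 2 * cheegerEnergy m f) ^ (1 / 2 : ℝ)

/-- The 2-capacity of `A`: the infimum of `‖u‖_{W^{1,2}}` over all Lipschitz `u : X → [0, 1]` that
are equal to `1` on a neighbourhood of `A`. -/
def twoCapacity (m : Measure X) (A : Set X) : ℝ≥0∞ :=
  ⨅ (u : X → ℝ) (_ : (∃ K, LipschitzWith K u) ∧ (∀ᶠ x in 𝓝ˢ A, u x = 1) ∧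
    ∀ x, 0 ≤ u x ∧ u x ≤ 1), sobolevNorm m u

/-- A Borel set is polar if it has zero 2-capacity. -/
def IsPolar (m : Measure X) (A : Set X) : Prop :=
  MeasurableSet A ∧ twoCapacity m A = 0

end MetricMeasure

/-! ## Smooth (weighted) Riemannian manifolds -/

/-- A smooth `n`-dimensional Riemannian manifold (Hausdorff, second countable, without boundary,
not assumed to be complete or connected). -/
structure RiemMfd (n : ℕ) where
  carrier : Type u
  [top : TopologicalSpace carrier]
  [t2 : T2Space carrier]
  [secondCountable : SecondCountableTopology carrier]
  [charted : ChartedSpace (EuclideanSpace ℝ (Fin n)) carrier]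
  [smooth : IsManifold 𝓘(ℝ, EuclideanSpace ℝ (Fin n)) ∞ carrier]
  metric : ContMDiffRiemannianMetric 𝓘(ℝ, EuclideanSpace ℝ (Fin n)) ∞ (EuclideanSpace ℝ (Fin n))
    (fun x : carrier => TangentSpace 𝓘(ℝ, EuclideanSpace ℝ (Fin n)) x)

namespace RiemMfd

variable {n : ℕ}

attribute [instance] RiemMfd.top RiemMfd.t2 RiemMfd.secondCountable RiemMfd.charted RiemMfd.smooth

instance (M : RiemMfd.{u} n) : MeasurableSpace M.carrier := borel _

instance (M : RiemMfd.{u} n) : BorelSpace M.carrier := ⟨rfl⟩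

/-- The Riemannian (extended) distance: the infimum of the lengths of the curves joining `x` and
`y`; it is `∞` if there is no such curve. -/
def riemDist (M : RiemMfd.{u} n) (x y : M.carrier) : ℝ≥0∞ :=
  letI : RiemannianBundle
      (fun x : M.carrier => TangentSpace 𝓘(ℝ, EuclideanSpace ℝ (Fin n)) x) :=
    ⟨M.metric.toRiemannianMetric⟩
  Manifold.riemannianEDist 𝓘(ℝ, EuclideanSpace ℝ (Fin n)) x y

/-- The matrix `g_{ij}(y)` of the metric in the local coordinates given by the chart `e`, at the
point of coordinates `y`. -/
def gram (M : RiemMfd.{u} n) (e : OpenPartialHomeomorph M.carrier (EuclideanSpace ℝ (Fin n)))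
    (y : EuclideanSpace ℝ (Fin n)) : Matrix (Fin n) (Fin n) ℝ :=
  Matrix.of fun i j =>
    M.metric.inner (e.symm y)
      (mfderiv 𝓘(ℝ, EuclideanSpace ℝ (Fin n)) 𝓘(ℝ, EuclideanSpace ℝ (Fin n)) e.symm y
        (EuclideanSpace.single i (1 : ℝ) : EuclideanSpace ℝ (Fin n)))
      (mfderiv 𝓘(ℝ, EuclideanSpace ℝ (Fin n)) 𝓘(ℝ, EuclideanSpace ℝ (Fin n)) e.symm y
        (EuclideanSpace.single j (1 : ℝ) : EuclideanSpace ℝ (Fin n)))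

/-- `μ` is the weighted volume measure `w dvol_g`: in every smooth chart it has the density
`w √(det g_{ij})` with respect to Lebesgue measure. -/
def IsWeightedVolume (M : RiemMfd.{u} n) (w : M.carrier → ℝ) (μ : Measure M.carrier) : Prop :=
  ∀ e ∈ IsManifold.maximalAtlas 𝓘(ℝ, EuclideanSpace ℝ (Fin n)) ∞ M.carrier,
    ∀ A : Set M.carrier, MeasurableSet A → A ⊆ e.source →
      μ A = ∫⁻ y in e '' A, ENNReal.ofReal (w (e.symm y) * √(M.gram e y).det)

/-- The total Riemannian volume is finite. -/
def HasFiniteVolume (M : RiemMfd.{u} n) : Prop :=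
  ∃ μ : Measure M.carrier, M.IsWeightedVolume (fun _ => 1) μ ∧ μ univ < ⊤

end RiemMfd

/-! ## The singular set of a metric measure space -/

section SingularSet

variable {X : Type u} [MetricSpace X] [MeasurableSpace X]

/-- `X \ S`, with the restricted distance and the restricted measure, is isomorphic to an open
subset of a smooth weighted Riemannian manifold `(M, g, e^φ dvol_g)`, with the distance and the
measure restricted to that open subset. -/
def HasSmoothComplement (m : Measure X) (S : Set X) : Prop :=
  ∃ (n : ℕ) (M : RiemMfd.{u} n) (φ : M.carrier → ℝ) (μ : Measure M.carrier)
    (ψ : ↥(Sᶜ) → M.carrier),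
    ContMDiff 𝓘(ℝ, EuclideanSpace ℝ (Fin n)) 𝓘(ℝ, ℝ) ∞ φ ∧
    M.IsWeightedVolume (fun x => Real.exp (φ x)) μ ∧
    IsOpenEmbedding ψ ∧
    (∀ x y, M.riemDist (ψ x) (ψ y) = edist x y) ∧
    (m.comap (Subtype.val : ↥(Sᶜ) → X)).map ψ = μ.restrict (range ψ)

/-- The singular set: the smallest closed set `S` such that `X \ S` is isomorphic to an open subset
of a smooth weighted Riemannian manifold, i.e. the intersection of all such closed sets. -/
def singularSet (m : Measure X) : Set X :=
  ⋂₀ {S : Set X | IsClosed S ∧ HasSmoothComplement m S}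

end SingularSet

/-! ## Asymptotically D`p`-brane metric measure spaces -/

/-- The harmonic function of a D`p`-brane: `(r / r₀)^(p - 7)` for `p < 7` and
`-(2π / g_s) log (r / r₀)` for `p = 7`. -/
def braneH (p : ℕ) (gs r₀ r : ℝ) : ℝ :=
  if p = 7 then -(2 * Real.pi / gs) * Real.log (r / r₀) else (r₀ / r) ^ (7 - p)

/-- A D`p`-brane end of a weighted Riemannian manifold `(R, g, e^f dvol_g)`.

It is parametrized by `M × {y ∈ ℝ^(9-p) : 0 < |y| < ε}`, where `(M, h)` is the Riemannian factor
`dx²` of dimension `p + 1 - d`. In polar coordinates `y = r Θ`, with `r = |y|` and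
`Θ ∈ S^(8-p)`, one has `|dy|² = dr² + r² ds²_{S^(8-p)}`, so that the model metric is
`h + H(|y|) |dy|²`. Being asymptotic is meant in the uniform `C⁰` sense as `r → 0`. -/
structure DpEnd (p d : ℕ) {n : ℕ} (R : RiemMfd.{u} n) (f : R.carrier → ℝ) where
  /-- The Riemannian factor `dx²`. -/
  M : RiemMfd.{u} (p + 1 - d)
  gs : ℝ
  gs_pos : 0 < gs
  r₀ : ℝ
  r₀_pos : 0 < r₀
  ε : ℝ
  ε_pos : 0 < ε
  /-- The parametrization of the end, a diffeomorphism onto an open subset of `R`. -/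
  Φ : OpenPartialHomeomorph (M.carrier × EuclideanSpace ℝ (Fin (9 - p))) R.carrier
  source_eq : Φ.source = {z | 0 < ‖z.2‖ ∧ ‖z.2‖ < ε}
  smooth_Φ : ContMDiffOn
    (𝓘(ℝ, EuclideanSpace ℝ (Fin (p + 1 - d))).prod 𝓘(ℝ, EuclideanSpace ℝ (Fin (9 - p))))
    𝓘(ℝ, EuclideanSpace ℝ (Fin n)) ∞ Φ Φ.source
  smooth_symm : ContMDiffOn 𝓘(ℝ, EuclideanSpace ℝ (Fin n))
    (𝓘(ℝ, EuclideanSpace ℝ (Fin (p + 1 - d))).prod 𝓘(ℝ, EuclideanSpace ℝ (Fin (9 - p))))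
    ∞ Φ.symm Φ.target
  /-- The end is glued to the rest of the manifold along its outer boundary `r = ε` only: the
  truncated ends `{0 < r ≤ δ}` are closed in `R`. -/
  isClosed_truncated : ∀ δ, 0 < δ → δ < ε → IsClosed (Φ '' {z | 0 < ‖z.2‖ ∧ ‖z.2‖ ≤ δ})
  /-- The metric is asymptotic to `h + H(r) |dy|²` as `r → 0`. -/
  metric_asymptotic : ∀ η > 0, ∃ δ > 0, ∀ (a : M.carrier) (y : EuclideanSpace ℝ (Fin (9 - p))),
    0 < ‖y‖ → ‖y‖ < ε → ‖y‖ < δ →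
    ∀ (v : TangentSpace 𝓘(ℝ, EuclideanSpace ℝ (Fin (p + 1 - d))) a)
      (w : EuclideanSpace ℝ (Fin (9 - p))),
      |R.metric.inner (Φ (a, y))
          (mfderiv
            (𝓘(ℝ, EuclideanSpace ℝ (Fin (p + 1 - d))).prod 𝓘(ℝ, EuclideanSpace ℝ (Fin (9 - p))))
            𝓘(ℝ, EuclideanSpace ℝ (Fin n)) Φ (a, y) (v, w))
          (mfderiv
            (𝓘(ℝ, EuclideanSpace ℝ (Fin (p + 1 - d))).prod 𝓘(ℝ, EuclideanSpace ℝ (Fin (9 - p))))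
            𝓘(ℝ, EuclideanSpace ℝ (Fin n)) Φ (a, y) (v, w))
        - (M.metric.inner a v v + braneH p gs r₀ ‖y‖ * ‖w‖ ^ 2)|
      ≤ η * (M.metric.inner a v v + braneH p gs r₀ ‖y‖ * ‖w‖ ^ 2)
  /-- The weight `e^f` is asymptotic to `H(r)^((p - 7) / 2)` as `r → 0`. -/
  weight_asymptotic : ∀ η > 0, ∃ δ > 0, ∀ (a : M.carrier) (y : EuclideanSpace ℝ (Fin (9 - p))),
    0 < ‖y‖ → ‖y‖ < ε → ‖y‖ < δ →
      |Real.exp (f (Φ (a, y))) - braneH p gs r₀ ‖y‖ ^ (((p : ℝ) - 7) / 2)|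
        ≤ η * braneH p gs r₀ ‖y‖ ^ (((p : ℝ) - 7) / 2)

/-- The structure of an asymptotically D`p`-brane metric measure space on `(X, d, m)`.

A smooth weighted Riemannian manifold `(R, g, e^f dvol_g)` of dimension `10 - d` with finitely many
D`p`-brane ends sits in `X` as an open dense subset, isometrically for the Riemannian distance; the
remaining points, the tips, are the limits `r → 0` in the ends and have measure zero. -/
structure AsymptoticallyDpBrane (X : Type u) [MetricSpace X] [MeasurableSpace X]
    (m : Measure X) (p d : ℕ) where
  /-- The smooth part of `X`. -/
  R : RiemMfd.{u} (10 - d)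
  f : R.carrier → ℝ
  smooth_f : ContMDiff 𝓘(ℝ, EuclideanSpace ℝ (Fin (10 - d))) 𝓘(ℝ, ℝ) ∞ f
  /-- The measure `e^f dvol_g`. -/
  vol : Measure R.carrier
  isWeightedVolume_vol : R.IsWeightedVolume (fun x => Real.exp (f x)) vol
  /-- The inclusion of the smooth part. -/
  incl : R.carrier → X
  isOpenEmbedding_incl : IsOpenEmbedding incl
  denseRange_incl : DenseRange incl
  edist_incl : ∀ a b, edist (incl a) (incl b) = R.riemDist a b
  measure_eq : m = vol.map incl
  numEnds : ℕ
  ends : Fin numEnds → DpEnd p d R f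
  disjoint_ends : Pairwise fun i j => Disjoint (ends i).Φ.target (ends j).Φ.target
  /-- For each `δ`, the tips together with the regions `{0 < r < δ}` of the ends form an open
  neighbourhood of the set of tips. -/
  isOpen_tips_union : ∀ δ, 0 < δ →
    IsOpen ((range incl)ᶜ ∪ ⋃ i, incl '' ((ends i).Φ '' {z | z ∈ (ends i).Φ.source ∧ ‖z.2‖ < δ}))

end

noncomputable section

/-! The complement of the tips is the smooth part `R` itself, so the singular set lies in the set of
tips. Everything else is done by logarithmic cutoffs in the transverse radius `r`: functions of `log
(ρ / r) / L` equal to `1` for `r ≤ ρ e^{-L}` and to `0` for `r ≥ ρ`. Since the metric is at least `H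
|dy|² / 2` near the tips, such a cutoff has gradient at most a constant times `1 / (L r √H)`, and
only on the annulus in between.

If `p ≤ 5`, then `H ≥ (r₀ / r)²`, so `r √H` is bounded below and the cutoffs are Lipschitz with
constant `O(1 / L)`. They equal `1` at a tip and tend to `0` at any fixed point of `R`, so a tip
would be infinitely far from `R`; there are no tips (`tips_eq_empty`).

If `p` is `6` or `7`, the weight `H^((p-7)/2)` times the transverse volume density `H^((9-p)/2)` is
exactly `H`, so the measure is at most a constant times `vol(M) H dy`
(`exists_measure_preimage_trans_le`, via monotonicity of determinants). In the energy this `H`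
cancels the `1 / H` of the squared gradient, leaving `L⁻² ∫ |y|⁻² dy` over the annulus in dimension
`9 - p ≥ 2`, which is `O(1 / L)` (`tendsto_lintegral_gradBound_sq`). The `L²` norms vanish by
dominated convergence, `H` being integrable and `M` of finite volume
(`tendsto_lintegral_cutoff_sq`). Summing over the ends gives admissible functions of arbitrarily
small Sobolev norm (`isPolar_of_cutoffs`). -/

theorem memLp_two_of_lintegral_lt_top {α : Type*} [MeasurableSpace α] {m : Measure α}
    {f : α → ℝ} (hf : AEStronglyMeasurable f m)
    (h : ∫⁻ x, ‖f x‖ₑ ^ 2 ∂m < ⊤) : MemLp f 2 m := by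
  refine ⟨hf, ?_⟩
  rw [eLpNorm_lt_top_iff_lintegral_rpow_enorm_lt_top (by norm_num) (by norm_num)]
  simpa using h

theorem eLpNorm_two_sq {α : Type*} [MeasurableSpace α] (m : Measure α) (f : α → ℝ) :
    eLpNorm f 2 m ^ 2 = ∫⁻ x, ‖f x‖ₑ ^ 2 ∂m := by
  rw [eLpNorm_eq_lintegral_rpow_enorm_toReal (by norm_num) (by norm_num), ← ENNReal.rpow_natCast,
    ← ENNReal.rpow_mul]
  simp

/-! ### Slope, Sobolev norm and capacity -/

section MetricMeasure

variable {X : Type u} [MetricSpace X]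

theorem metricSlope_le {f : X → ℝ} {x : X} {K : ℝ≥0∞}
    (h : ∀ᶠ y in 𝓝 x, edist (f y) (f x) ≤ K * edist y x) : metricSlope f x ≤ K := by
  refine limsup_le_of_le (by isBoundedDefault) ?_
  filter_upwards [nhdsWithin_le_nhds h, self_mem_nhdsWithin] with y hy hne
  exact ENNReal.div_le_of_le_mul hy

theorem metricSlope_le_of_lipschitz {f : X → ℝ} {K : NNReal} (hf : LipschitzWith K f) (x : X) :
    metricSlope f x ≤ K :=
  metricSlope_le (Eventually.of_forall fun y => hf y x)

theorem metricSlope_eq_iInf (f : X → ℝ) (x : X) :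
    metricSlope f x = ⨅ n : ℕ, ⨆ y, ⨆ (_ : y ∈ Metric.ball x (1 / ((n : ℝ) + 1)) ∩ {x}ᶜ),
      edist (f y) (f x) / edist y x := by
  unfold metricSlope
  rw [(nhdsWithin_hasBasis Metric.nhds_basis_ball_inv_nat_succ _).limsup_eq_iInf_iSup]
  simp

/-- For fixed `y`, the constraint `0 < d(x, y) < r` is open in `x` and the quotient is continuous
there. With `metricSlope_eq_iInf` this makes the slope a countable infimum of Borel functions,
although the suprema are uncountable. -/
theorem lowerSemicontinuous_iSup_quotient {f : X → ℝ} (hf : Continuous f) (r : ℝ) :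
    LowerSemicontinuous fun x => ⨆ y, ⨆ (_ : y ∈ Metric.ball x r ∩ {x}ᶜ),
      edist (f y) (f x) / edist y x := by
  intro x c hc
  simp only [lt_iSup_iff] at hc
  obtain ⟨y, ⟨hy, hne⟩, hc⟩ := hc
  have h1 : ∀ᶠ z in 𝓝 x, dist y z < r :=
    (continuous_const.dist continuous_id).continuousAt.eventually (gt_mem_nhds hy)
  have h2 : ∀ᶠ z in 𝓝 x, y ≠ z := by
    have : x ∈ ({y}ᶜ : Set X) := fun h => hne h.symm
    filter_upwards [isOpen_compl_singleton.mem_nhds this] with z hz h using hz h.symm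
  have h3 : Tendsto (fun z => edist (f y) (f z) / edist y z) (𝓝 x)
      (𝓝 (edist (f y) (f x) / edist y x)) := by
    refine ENNReal.Tendsto.div ?_ (Or.inr ?_) ?_ (Or.inl (edist_ne_top _ _))
    · exact (continuous_const.edist hf).continuousAt
    · simpa [edist_eq_zero] using hne
    · exact (continuous_const.edist continuous_id).continuousAt
  filter_upwards [h1, h2, h3.eventually (lt_mem_nhds hc)] with z hz1 hz2 hz3
  exact hz3.trans_le (le_iSup₂_of_le y ⟨hz1, hz2⟩ le_rfl)

variable [MeasurableSpace X]

theorem measurable_metricSlope [BorelSpace X] {f : X → ℝ} (hf : Continuous f) :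
    Measurable (metricSlope f) := by
  have : metricSlope f = fun x => ⨅ n : ℕ, ⨆ y,
      ⨆ (_ : y ∈ Metric.ball x (1 / ((n : ℝ) + 1)) ∩ {x}ᶜ), edist (f y) (f x) / edist y x :=
    funext (metricSlope_eq_iInf f)
  rw [this]
  exact Measurable.iInf fun n => (lowerSemicontinuous_iSup_quotient hf _).measurable

theorem lintegral_enorm_sq_toReal_metricSlope {f : X → ℝ} {K : NNReal} (hf : LipschitzWith K f)
    (m : Measure X) :
    ∫⁻ x, ‖(metricSlope f x).toReal‖ₑ ^ 2 ∂m = ∫⁻ x, metricSlope f x ^ 2 ∂m := by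
  congr with x
  rw [Real.enorm_of_nonneg ENNReal.toReal_nonneg, ENNReal.ofReal_toReal]
  exact ((metricSlope_le_of_lipschitz hf x).trans_lt ENNReal.coe_lt_top).ne

/-- The slope of a Lipschitz function is a relaxed gradient, so it bounds the Sobolev norm. -/
theorem sobolevNorm_sq_le [BorelSpace X] {m : Measure X} {f : X → ℝ} {K : NNReal}
    (hf : LipschitzWith K f) (h0 : ∫⁻ x, ‖f x‖ₑ ^ 2 ∂m < ⊤)
    (h1 : ∫⁻ x, metricSlope f x ^ 2 ∂m < ⊤) :
    sobolevNorm m f ^ 2 ≤ ∫⁻ x, ‖f x‖ₑ ^ 2 ∂m + ∫⁻ x, metricSlope f x ^ 2 ∂m := by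
  have hm0 : MemLp f 2 m := memLp_two_of_lintegral_lt_top
    hf.continuous.measurable.aestronglyMeasurable h0
  have hm1 : MemLp (fun x => (metricSlope f x).toReal) 2 m := by
    refine memLp_two_of_lintegral_lt_top
      (measurable_metricSlope hf.continuous).ennreal_toReal.aestronglyMeasurable ?_
    rwa [lintegral_enorm_sq_toReal_metricSlope hf]
  have hrel : IsRelaxedGradient m f fun x => (metricSlope f x).toReal := by
    refine ⟨hm1, fun _ => f, _, fun _ => ⟨K, hf⟩, fun _ => hm0, fun _ => hm1, ?_, hm1,
      fun h _ => tendsto_const_nhds, EventuallyLE.rfl⟩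
    simp
  have hch : 2 * cheegerEnergy m f ≤ ∫⁻ x, metricSlope f x ^ 2 ∂m := by
    unfold cheegerEnergy
    rw [← mul_assoc, ENNReal.mul_inv_cancel (by norm_num) (by norm_num), one_mul,
      ← lintegral_enorm_sq_toReal_metricSlope hf]
    exact iInf₂_le _ hrel
  unfold sobolevNorm
  rw [← ENNReal.rpow_natCast, ← ENNReal.rpow_mul, eLpNorm_two_sq]
  norm_num
  gcongr

/-- A set is polar if it is Borel and is surrounded by Lipschitz cutoffs of arbitrarily small
`L²`-norm and slope. -/
theorem isPolar_of_cutoffs [BorelSpace X] {m : Measure X} {A : Set X} (hA : MeasurableSet A)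
    (u : ℕ → X → ℝ) (hlip : ∀ n, ∃ K, LipschitzWith K (u n))
    (hone : ∀ n, ∀ᶠ x in 𝓝ˢ A, u n x = 1) (hu : ∀ n x, 0 ≤ u n x ∧ u n x ≤ 1)
    (h0 : Tendsto (fun n => ∫⁻ x, ‖u n x‖ₑ ^ 2 ∂m) atTop (𝓝 0))
    (h1 : Tendsto (fun n => ∫⁻ x, metricSlope (u n) x ^ 2 ∂m) atTop (𝓝 0)) : IsPolar m A := by
  refine ⟨hA, ?_⟩
  have hcap : ∀ᶠ n in atTop, twoCapacity m A ^ 2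
      ≤ ∫⁻ x, ‖u n x‖ₑ ^ 2 ∂m + ∫⁻ x, metricSlope (u n) x ^ 2 ∂m := by
    filter_upwards [h0.eventually (gt_mem_nhds ENNReal.zero_lt_top),
      h1.eventually (gt_mem_nhds ENNReal.zero_lt_top)] with n hn0 hn1
    obtain ⟨K, hK⟩ := hlip n
    refine le_trans ?_ (sobolevNorm_sq_le hK hn0 hn1)
    gcongr
    exact iInf₂_le (u n) ⟨⟨K, hK⟩, hone n, hu n⟩
  have h := ge_of_tendsto (h0.add h1) hcap
  simpa using h

theorem isPolar_empty [BorelSpace X] (m : Measure X) : IsPolar m (∅ : Set X) := by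
  have hs : ∀ x : X, metricSlope (fun _ => (0 : ℝ)) x = 0 := fun x =>
    le_antisymm (metricSlope_le (K := 0) (by simp)) zero_le
  refine isPolar_of_cutoffs MeasurableSet.empty (fun _ _ => 0) (fun _ => ⟨0, LipschitzWith.const 0⟩)
    (by simp) (by simp) (by simp) (by simp [hs])

end MetricMeasure

/-! ### From gradient bounds to difference quotients for the Riemannian distance -/

namespace RiemMfd

variable {n : ℕ}

/-- The Riemannian structure on the tangent bundle given by the metric. -/
abbrev bundle (M : RiemMfd.{u} n) : RiemannianBundle
    (fun x : M.carrier => TangentSpace 𝓘(ℝ, EuclideanSpace ℝ (Fin n)) x) :=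
  ⟨M.metric.toRiemannianMetric⟩

theorem norm_tangent (M : RiemMfd.{u} n) {x : M.carrier}
    (v : TangentSpace 𝓘(ℝ, EuclideanSpace ℝ (Fin n)) x) :
    letI := M.bundle
    ‖v‖ = √(M.metric.inner x v v) := by
  let _ := M.bundle
  exact norm_eq_sqrt_real_inner v

/-- The differential of a real function, as a real valued map on each tangent space. -/
def differential (M : RiemMfd.{u} n) (u : M.carrier → ℝ) (x : M.carrier)
    (v : TangentSpace 𝓘(ℝ, EuclideanSpace ℝ (Fin n)) x) : ℝ :=
  mfderiv 𝓘(ℝ, EuclideanSpace ℝ (Fin n)) 𝓘(ℝ, ℝ) u x v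

/-- The differential of `u` has norm at most `K` at the points of `U`. -/
def GradientBoundOn (M : RiemMfd.{u} n) (u : M.carrier → ℝ) (K : NNReal) (U : Set M.carrier) :
    Prop :=
  ∀ x ∈ U, ∀ v : TangentSpace 𝓘(ℝ, EuclideanSpace ℝ (Fin n)) x,
    |M.differential u x v| ≤ K * √(M.metric.inner x v v)

theorem edist_le_mul_pathELength (M : RiemMfd.{u} n) {u : M.carrier → ℝ} {K : NNReal}
    {U : Set M.carrier}
    (hu : ContMDiff 𝓘(ℝ, EuclideanSpace ℝ (Fin n)) 𝓘(ℝ, ℝ) 1 u)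
    (hK : M.GradientBoundOn u K U) {γ : ℝ → M.carrier}
    (hγ : ContMDiffOn 𝓘(ℝ, ℝ) 𝓘(ℝ, EuclideanSpace ℝ (Fin n)) 1 γ (Icc 0 1))
    (hU : ∀ t ∈ Icc (0 : ℝ) 1, γ t ∈ U) :
    letI := M.bundle
    edist (u (γ 0)) (u (γ 1)) ≤ K * pathELength 𝓘(ℝ, EuclideanSpace ℝ (Fin n)) γ 0 1 := by
  let _ := M.bundle
  have D : ContDiffOn ℝ 1 (u ∘ γ) (Icc 0 1) := contMDiffOn_iff_contDiffOn.mp (hu.comp_contMDiffOn hγ)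
  rw [edist_comm, edist_eq_enorm_sub]
  refine (enorm_sub_le_lintegral_derivWithin_Icc_of_contDiffOn_Icc D zero_le_one).trans ?_
  rw [pathELength_eq_lintegral_mfderivWithin_Icc, ← lintegral_const_mul' _ _ ENNReal.coe_ne_top]
  refine setLIntegral_mono' measurableSet_Icc fun t ht => ?_
  have hcomp : derivWithin (u ∘ γ) (Icc 0 1) t
      = M.differential u (γ t)
        (mfderivWithin 𝓘(ℝ, ℝ) 𝓘(ℝ, EuclideanSpace ℝ (Fin n)) γ (Icc 0 1) t 1) := by
    rw [← fderivWithin_derivWithin, ← mfderivWithin_eq_fderivWithin,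
      mfderiv_comp_mfderivWithin t ((hu.mdifferentiable one_ne_zero) _)
        (hγ.mdifferentiableOn one_ne_zero t ht)
        ((uniqueDiffOn_Icc zero_lt_one t ht).uniqueMDiffWithinAt)]
    rfl
  have h := hK (γ t) (hU t ht) (mfderivWithin 𝓘(ℝ, ℝ) 𝓘(ℝ, EuclideanSpace ℝ (Fin n)) γ (Icc 0 1) t 1)
  rw [← M.norm_tangent] at h
  rw [hcomp, Real.enorm_eq_ofReal_abs, ← ofReal_norm, ← ENNReal.ofReal_coe_nnreal,
    ← ENNReal.ofReal_mul K.coe_nonneg]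
  exact ENNReal.ofReal_le_ofReal h

/-- A curve from `x` of length less than `s` never leaves the ball of radius `s` about `x`, so the
gradient bound is needed only there. This one lemma covers both the local slope and, with `s = ⊤`,
the global Lipschitz constant. -/
theorem edist_le_mul_riemDist (M : RiemMfd.{u} n) {u : M.carrier → ℝ} {K : NNReal}
    {U : Set M.carrier} (hu : ContMDiff 𝓘(ℝ, EuclideanSpace ℝ (Fin n)) 𝓘(ℝ, ℝ) 1 u)
    (hK : M.GradientBoundOn u K U) {x y : M.carrier} {s : ℝ≥0∞}
    (hs : ∀ z, M.riemDist x z < s → z ∈ U) (hy : M.riemDist x y < s) :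
    edist (u x) (u y) ≤ K * M.riemDist x y := by
  let _ := M.bundle
  -- A minimizing curve need not exist, so lengths `r` slightly above the distance are used and `r`
  -- then decreases to it.
  have : (𝓝[>] M.riemDist x y).NeBot := nhdsGT_neBot_of_exists_gt ⟨s, hy⟩
  have hlim : Tendsto (fun r : ℝ≥0∞ => K * r) (𝓝[>] M.riemDist x y) (𝓝 (K * M.riemDist x y)) :=
    ((ENNReal.continuous_const_mul ENNReal.coe_ne_top).tendsto _).mono_left nhdsWithin_le_nhds
  refine ge_of_tendsto hlim ?_
  filter_upwards [Ioo_mem_nhdsGT hy] with r hr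
  obtain ⟨γ, h0, h1, hγ, hlen⟩ := exists_lt_of_riemannianEDist_lt (show
    riemannianEDist 𝓘(ℝ, EuclideanSpace ℝ (Fin n)) x y < r from hr.1)
  have hU : ∀ t ∈ Icc (0 : ℝ) 1, γ t ∈ U := fun t ht => hs _ <| calc
    M.riemDist x (γ t) ≤ pathELength 𝓘(ℝ, EuclideanSpace ℝ (Fin n)) γ 0 t :=
      riemannianEDist_le_pathELength (hγ.mono (Icc_subset_Icc le_rfl ht.2)) h0 rfl ht.1
    _ ≤ pathELength 𝓘(ℝ, EuclideanSpace ℝ (Fin n)) γ 0 1 := pathELength_mono le_rfl ht.2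
    _ < s := hlen.trans hr.2
  have h := M.edist_le_mul_pathELength hu hK hγ hU
  rw [h0, h1] at h
  refine h.trans ?_
  gcongr

/-- If the topology of `M` is induced by the Riemannian distance, a bound on the gradient near `x`
is a bound on the difference quotients at `x`. -/
theorem eventually_edist_le (M : RiemMfd.{u} n) {X : Type*} [MetricSpace X] {ι : M.carrier → X}
    (hι : IsOpenEmbedding ι) (hd : ∀ a b, edist (ι a) (ι b) = M.riemDist a b)
    {u : M.carrier → ℝ} {K : NNReal} (hu : ContMDiff 𝓘(ℝ, EuclideanSpace ℝ (Fin n)) 𝓘(ℝ, ℝ) 1 u)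
    {x : M.carrier} {U : Set M.carrier} (hU : U ∈ 𝓝 x) (hK : M.GradientBoundOn u K U) :
    ∀ᶠ y in 𝓝 x, edist (u y) (u x) ≤ K * edist (ι y) (ι x) := by
  rw [hι.isInducing.nhds_eq_comap, mem_comap] at hU
  obtain ⟨V, hV, hVU⟩ := hU
  obtain ⟨s, hs, hsV⟩ := EMetric.mem_nhds_iff.1 hV
  have : ∀ᶠ y in 𝓝 x, edist (ι y) (ι x) < s :=
    hι.continuous.continuousAt (Metric.eball_mem_nhds _ hs)
  filter_upwards [this] with y hy
  rw [edist_comm, edist_comm (ι y), hd]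
  rw [edist_comm, hd] at hy
  refine M.edist_le_mul_riemDist hu hK (fun z hz => hVU (hsV ?_)) hy
  rwa [← hd, edist_comm] at hz

end RiemMfd

/-! ### Monotonicity of the determinant -/

namespace Matrix

variable {ι : Type*} [Fintype ι] [DecidableEq ι]

/-- Evaluating the characteristic polynomial of `P` at `-1` shows that the determinant is the
product of the factors `1 + λᵢ` over the eigenvalues `λᵢ ≥ 0`. -/
theorem PosSemidef.one_le_det_one_add {P : Matrix ι ι ℝ} (hP : P.PosSemidef) :
    1 ≤ (1 + P).det := by
  have h := congrArg (Polynomial.eval (-1)) hP.1.charpoly_eq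
  rw [eval_charpoly, Polynomial.eval_prod] at h
  have h1 : (scalar ι (-1 : ℝ) - P).det = (-1) ^ Fintype.card ι * (1 + P).det := by
    rw [← det_neg]
    congr 1
    ext i j
    simp [scalar_apply, diagonal_apply, one_apply]
    split_ifs <;> ring
  have h2 : ∏ i, Polynomial.eval (-1) (Polynomial.X - Polynomial.C (hP.1.eigenvalues i : ℝ))
      = (-1) ^ Fintype.card ι * ∏ i, (1 + hP.1.eigenvalues i) := by
    rw [← Finset.card_univ, ← Finset.prod_const, ← Finset.prod_mul_distrib]
    refine Finset.prod_congr rfl fun i _ => ?_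
    simp
    ring
  have h3 : (1 + P).det = ∏ i, (1 + hP.1.eigenvalues i) :=
    mul_left_cancel₀ (pow_ne_zero _ (by norm_num)) (h1.symm.trans (h.trans h2))
  rw [h3]
  calc (1 : ℝ) = ∏ _i : ι, (1 : ℝ) := by simp
    _ ≤ _ := Finset.prod_le_prod (by simp) fun i _ => by linarith [hP.eigenvalues_nonneg i]

open scoped MatrixOrder in
-- For invertible `A` with square root `S`, factor `A + C = S (1 + S⁻¹ C S⁻¹) S` and apply the
-- previous bound to the middle factor. For singular `A` the left side is `0`.
theorem PosSemidef.det_le_det_add {A C : Matrix ι ι ℝ} (hA : A.PosSemidef) (hC : C.PosSemidef) :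
    A.det ≤ (A + C).det := by
  by_cases hdet : A.det = 0
  · rw [hdet]
    exact (hA.add hC).det_nonneg
  have hS : (CFC.sqrt A).PosSemidef := nonneg_iff_posSemidef.1 (CFC.sqrt_nonneg A)
  have hSS : CFC.sqrt A * CFC.sqrt A = A := CFC.sqrt_mul_sqrt_self A (nonneg_iff_posSemidef.2 hA)
  set S := CFC.sqrt A
  have hSdet : IsUnit S.det := by
    rw [isUnit_iff_ne_zero]
    intro h
    apply hdet
    rw [← hSS, det_mul, h, zero_mul]
  have hP : (S⁻¹ * C * S⁻¹).PosSemidef := by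
    have := hC.conjTranspose_mul_mul_same S⁻¹
    rwa [hS.inv.1.eq] at this
  have hfac : A + C = S * (1 + S⁻¹ * C * S⁻¹) * S := by
    rw [mul_add, add_mul, mul_one, hSS]
    congr 1
    rw [← mul_assoc, ← mul_assoc, mul_nonsing_inv _ hSdet, one_mul, mul_assoc,
      nonsing_inv_mul _ hSdet, mul_one]
  have h1 : (A + C).det = A.det * (1 + S⁻¹ * C * S⁻¹).det := by
    conv_rhs => rw [← hSS]
    rw [hfac, det_mul, det_mul, det_mul]
    ring
  rw [h1]
  exact le_mul_of_one_le_right hA.det_nonneg hP.one_le_det_one_add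

/-- The determinant is monotone on positive semidefinite matrices. -/
theorem PosSemidef.det_le_det {A B : Matrix ι ι ℝ} (hA : A.PosSemidef) (hB : B.IsHermitian)
    (h : ∀ x, x ⬝ᵥ (A *ᵥ x) ≤ x ⬝ᵥ (B *ᵥ x)) : A.det ≤ B.det := by
  have hC : (B - A).PosSemidef := by
    refine .of_dotProduct_mulVec_nonneg (hB.sub hA.1) fun x => ?_
    simp only [star_trivial, sub_mulVec, dotProduct_sub]
    linarith [h x]
  simpa using hA.det_le_det_add hC

end Matrix

/-! ### Gram matrices as quadratic forms -/

namespace RiemMfd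

open Matrix

variable {n k l : ℕ}

/-- The coordinate vector field combination `∑ xᵢ ∂ᵢ` of the chart `e`. -/
def coordVec (M : RiemMfd.{u} n) (e : OpenPartialHomeomorph M.carrier (EuclideanSpace ℝ (Fin n)))
    (y ξ : EuclideanSpace ℝ (Fin n)) :
    TangentSpace 𝓘(ℝ, EuclideanSpace ℝ (Fin n)) (e.symm y) :=
  mfderiv 𝓘(ℝ, EuclideanSpace ℝ (Fin n)) 𝓘(ℝ, EuclideanSpace ℝ (Fin n)) e.symm y ξ

/-- This turns an inequality between metrics on tangent vectors into one between quadratic forms of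
matrices, hence between volume densities. -/
theorem gram_quadForm (M : RiemMfd.{u} n)
    (e : OpenPartialHomeomorph M.carrier (EuclideanSpace ℝ (Fin n)))
    (y ξ : EuclideanSpace ℝ (Fin n)) :
    ξ.ofLp ⬝ᵥ (M.gram e y *ᵥ ξ.ofLp)
      = M.metric.inner (e.symm y) (M.coordVec e y ξ) (M.coordVec e y ξ) := by
  have hξ : ξ = ∑ i, ξ i • EuclideanSpace.single i (1 : ℝ) := by
    ext j
    simp [Finset.sum_apply, Pi.single_apply]
  have h : M.coordVec e y ξ
      = ∑ i, ξ i • M.coordVec e y (EuclideanSpace.single i (1 : ℝ)) := by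
    conv_lhs => rw [hξ]
    unfold coordVec
    erw [map_sum]
    refine Finset.sum_congr rfl fun i _ => ?_
    erw [map_smul]
  rw [h]
  simp only [map_sum, map_smul, _root_.sum_apply, _root_.smul_apply,
    smul_eq_mul, dotProduct, mulVec, Finset.mul_sum]
  rw [Finset.sum_comm]
  refine Finset.sum_congr rfl fun i _ => Finset.sum_congr rfl fun j _ => ?_
  change _ * (M.metric.inner (e.symm y) (M.coordVec e y (EuclideanSpace.single j (1 : ℝ)))
    (M.coordVec e y (EuclideanSpace.single i (1 : ℝ))) * _) = _
  ring

theorem inner_self_nonneg (M : RiemMfd.{u} n) {x : M.carrier}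
    (v : TangentSpace 𝓘(ℝ, EuclideanSpace ℝ (Fin n)) x) : 0 ≤ M.metric.inner x v v := by
  by_cases hv : v = 0
  · simp [hv]
  · exact (M.metric.pos x v hv).le

theorem gram_posSemidef (M : RiemMfd.{u} n)
    (e : OpenPartialHomeomorph M.carrier (EuclideanSpace ℝ (Fin n)))
    (y : EuclideanSpace ℝ (Fin n)) : (M.gram e y).PosSemidef := by
  refine .of_dotProduct_mulVec_nonneg ?_ fun x => ?_
  · ext i j
    exact M.metric.symm _ _ _
  · have := M.gram_quadForm e y (WithLp.toLp 2 x)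
    simp only [star_trivial]
    rw [this]
    exact M.inner_self_nonneg _

end RiemMfd

/-! ### Product coordinates on an end and the density in them -/

/-- The measure preserving linear isomorphism `ℝᵏ × ℝˡ ≃ ℝⁿ` for `k + l = n`. -/
def euclideanProdEquiv {k l n : ℕ} (h : k + l = n) :
    (EuclideanSpace ℝ (Fin k) × EuclideanSpace ℝ (Fin l)) ≃L[ℝ] EuclideanSpace ℝ (Fin n) :=
  EuclideanSpace.sumEquivProd.symm.trans (LinearIsometryEquiv.piLpCongrLeft 2 ℝ ℝ
    (finSumFinEquiv.trans (finCongr h))).toContinuousLinearEquiv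

theorem measurePreserving_euclideanProdEquiv {k l n : ℕ} (h : k + l = n) :
    MeasurePreserving (euclideanProdEquiv h) := by
  have h1 := (LinearIsometryEquiv.piLpCongrLeft 2 ℝ ℝ
    (finSumFinEquiv.trans (finCongr h))).measurePreserving
  have h2 := (PiLp.sumPiLpEquivProdLpPiLp 2 (fun _ : Fin k ⊕ Fin l => ℝ)).symm.measurePreserving
  have h3 := WithLp.volume_preserving_toLp (EuclideanSpace ℝ (Fin k)) (EuclideanSpace ℝ (Fin l))
  exact h1.comp (h2.comp h3)

theorem euclideanProdEquiv_apply {k l n : ℕ} (h : k + l = n)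
    (z : EuclideanSpace ℝ (Fin k) × EuclideanSpace ℝ (Fin l)) (i : Fin k ⊕ Fin l) :
    euclideanProdEquiv h z ((finSumFinEquiv.trans (finCongr h)) i)
      = Sum.elim z.1.ofLp z.2.ofLp i := by
  rcases i with i | i <;> simp [euclideanProdEquiv, LinearIsometryEquiv.piLpCongrLeft_apply]

/-- The first factor of the inverse of `euclideanProdEquiv`. -/
def euclideanFst {k l n : ℕ} (h : k + l = n) :
    EuclideanSpace ℝ (Fin n) →L[ℝ] EuclideanSpace ℝ (Fin k) :=
  (ContinuousLinearMap.fst ℝ (EuclideanSpace ℝ (Fin k)) (EuclideanSpace ℝ (Fin l))).comp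
    (euclideanProdEquiv h).symm.toContinuousLinearMap

/-- The second factor of the inverse of `euclideanProdEquiv`. -/
def euclideanSnd {k l n : ℕ} (h : k + l = n) :
    EuclideanSpace ℝ (Fin n) →L[ℝ] EuclideanSpace ℝ (Fin l) :=
  (ContinuousLinearMap.snd ℝ (EuclideanSpace ℝ (Fin k)) (EuclideanSpace ℝ (Fin l))).comp
    (euclideanProdEquiv h).symm.toContinuousLinearMap

theorem euclideanFst_apply {k l n : ℕ} (h : k + l = n)
    (z : EuclideanSpace ℝ (Fin k) × EuclideanSpace ℝ (Fin l)) :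
    euclideanFst h (euclideanProdEquiv h z) = z.1 :=
  congrArg Prod.fst ((euclideanProdEquiv h).symm_apply_apply z)

theorem euclideanSnd_apply {k l n : ℕ} (h : k + l = n)
    (z : EuclideanSpace ℝ (Fin k) × EuclideanSpace ℝ (Fin l)) :
    euclideanSnd h (euclideanProdEquiv h z) = z.2 :=
  congrArg Prod.snd ((euclideanProdEquiv h).symm_apply_apply z)

namespace RiemMfd

open Matrix

variable {n k l : ℕ}

/-- The chart of `R` obtained from a parametrization `Φ` by `M × ℝˡ` and a chart of `M`. -/
def prodChart {R : RiemMfd.{u} n} {M : RiemMfd.{u} k} (h : k + l = n)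
    (Φ : OpenPartialHomeomorph (M.carrier × EuclideanSpace ℝ (Fin l)) R.carrier)
    (c : OpenPartialHomeomorph M.carrier (EuclideanSpace ℝ (Fin k))) :
    OpenPartialHomeomorph R.carrier (EuclideanSpace ℝ (Fin n)) :=
  Φ.symm ≫ₕ (c.prod (OpenPartialHomeomorph.refl _)) ≫ₕ
    (euclideanProdEquiv h).toHomeomorph.toOpenPartialHomeomorph

/-- `Φ` is a diffeomorphism from an open subset of `M × ℝˡ` onto an open subset of `R`. -/
structure IsSmoothParam {R : RiemMfd.{u} n} {M : RiemMfd.{u} k}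
    (Φ : OpenPartialHomeomorph (M.carrier × EuclideanSpace ℝ (Fin l)) R.carrier) : Prop where
  smooth : ContMDiffOn (𝓘(ℝ, EuclideanSpace ℝ (Fin k)).prod 𝓘(ℝ, EuclideanSpace ℝ (Fin l)))
    𝓘(ℝ, EuclideanSpace ℝ (Fin n)) ∞ Φ Φ.source
  smooth_symm : ContMDiffOn 𝓘(ℝ, EuclideanSpace ℝ (Fin n))
    (𝓘(ℝ, EuclideanSpace ℝ (Fin k)).prod 𝓘(ℝ, EuclideanSpace ℝ (Fin l))) ∞ Φ.symm Φ.target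

variable {R : RiemMfd.{u} n} {M : RiemMfd.{u} k}
  {Φ : OpenPartialHomeomorph (M.carrier × EuclideanSpace ℝ (Fin l)) R.carrier}

theorem contMDiff_euclideanProdEquiv (h : k + l = n) :
    ContMDiff (𝓘(ℝ, EuclideanSpace ℝ (Fin k)).prod 𝓘(ℝ, EuclideanSpace ℝ (Fin l)))
      𝓘(ℝ, EuclideanSpace ℝ (Fin n)) ∞ (euclideanProdEquiv h) := by
  exact (euclideanProdEquiv h).contDiff.contMDiff.comp (contMDiff_fst.prodMk_space contMDiff_snd)

theorem contMDiff_euclideanProdEquiv_symm (h : k + l = n) :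
    ContMDiff 𝓘(ℝ, EuclideanSpace ℝ (Fin n))
      (𝓘(ℝ, EuclideanSpace ℝ (Fin k)).prod 𝓘(ℝ, EuclideanSpace ℝ (Fin l))) ∞
      (euclideanProdEquiv h).symm := by
  exact (euclideanFst h).contDiff.contMDiff.prodMk (euclideanSnd h).contDiff.contMDiff

/-- A weighted volume is known only through its densities in charts of the maximal atlas, so the
product charts have to be recognized as such charts. -/
theorem prodChart_mem_maximalAtlas (h : k + l = n) (hΦ : IsSmoothParam Φ)
    {c : OpenPartialHomeomorph M.carrier (EuclideanSpace ℝ (Fin k))}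
    (hc : c ∈ IsManifold.maximalAtlas 𝓘(ℝ, EuclideanSpace ℝ (Fin k)) ∞ M.carrier) :
    prodChart h Φ c ∈ IsManifold.maximalAtlas 𝓘(ℝ, EuclideanSpace ℝ (Fin n)) ∞ R.carrier := by
  refine OpenPartialHomeomorph.mem_maximalAtlas_of_contMDiffOn _ ?_ ?_
  · refine (contMDiff_euclideanProdEquiv h).comp_contMDiffOn
      (((contMDiffOn_of_mem_maximalAtlas hc).prodMap
        (contMDiffOn_id (s := univ))).comp
        (hΦ.smooth_symm.mono ?_) ?_)
    · intro x hx
      simp [prodChart] at hx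
      exact hx.1
    · intro x hx
      simp [prodChart] at hx
      simpa using hx.2
  · refine hΦ.smooth.comp
      ((((contMDiffOn_symm_of_mem_maximalAtlas hc).prodMap
        (contMDiffOn_id (s := univ))).comp
        (contMDiff_euclideanProdEquiv_symm h).contMDiffOn (s := (prodChart h Φ c).target) ?_)) ?_
    · intro x hx
      simp [prodChart] at hx
      simpa using hx.1
    · intro x hx
      simp [prodChart] at hx
      simpa using hx.2

theorem prodChart_symm_apply (h : k + l = n)
    (c : OpenPartialHomeomorph M.carrier (EuclideanSpace ℝ (Fin k)))
    (z : EuclideanSpace ℝ (Fin k) × EuclideanSpace ℝ (Fin l)) :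
    (prodChart h Φ c).symm (euclideanProdEquiv h z) = Φ (c.symm z.1, z.2) := by
  simp [prodChart]

/-- The metric of `R` is at most `κ (h + H |dy|²)` at the point `Φ z`. -/
def MetricLE (Φ : OpenPartialHomeomorph (M.carrier × EuclideanSpace ℝ (Fin l)) R.carrier)
    (κ H : ℝ) (z : M.carrier × EuclideanSpace ℝ (Fin l)) : Prop :=
  ∀ (v : TangentSpace 𝓘(ℝ, EuclideanSpace ℝ (Fin k)) z.1) (w : EuclideanSpace ℝ (Fin l)),
    R.metric.inner (Φ z)
      (mfderiv (𝓘(ℝ, EuclideanSpace ℝ (Fin k)).prod 𝓘(ℝ, EuclideanSpace ℝ (Fin l)))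
        𝓘(ℝ, EuclideanSpace ℝ (Fin n)) Φ z (v, w))
      (mfderiv (𝓘(ℝ, EuclideanSpace ℝ (Fin k)).prod 𝓘(ℝ, EuclideanSpace ℝ (Fin l)))
        𝓘(ℝ, EuclideanSpace ℝ (Fin n)) Φ z (v, w))
    ≤ κ * (M.metric.inner z.1 v v + H * ‖w‖ ^ 2)

/-- Tangent spaces at equal points are distinct types depending on the point; transporting the
derivative once here avoids rewriting base points inside such types. -/
theorem hasMFDerivAt_of_eq {E F H G A B : Type*} [NormedAddCommGroup E] [NormedSpace ℝ E]
    [NormedAddCommGroup F] [NormedSpace ℝ F] [TopologicalSpace H] [TopologicalSpace G]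
    {I : ModelWithCorners ℝ E H} {J : ModelWithCorners ℝ F G} [TopologicalSpace A]
    [ChartedSpace H A] [TopologicalSpace B] [ChartedSpace G B] {f : A → B} {x y : A}
    (hf : MDifferentiableAt I J f x) (h : y = x) :
    HasMFDerivAt I J f y (mfderiv I J f x : E →L[ℝ] F) := by
  subst h
  exact hf.hasMFDerivAt

/-- The chain rule, the inverse of the product chart being `Φ ∘ (c⁻¹ × id)` in the split
coordinates. -/
theorem coordVec_prodChart (h : k + l = n) (hΦ : IsSmoothParam Φ)
    {c : OpenPartialHomeomorph M.carrier (EuclideanSpace ℝ (Fin k))}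
    (hc : c ∈ IsManifold.maximalAtlas 𝓘(ℝ, EuclideanSpace ℝ (Fin k)) ∞ M.carrier)
    {z : EuclideanSpace ℝ (Fin k) × EuclideanSpace ℝ (Fin l)} (hz : z.1 ∈ c.target)
    (hzs : (c.symm z.1, z.2) ∈ Φ.source)
    (ξ : EuclideanSpace ℝ (Fin k) × EuclideanSpace ℝ (Fin l)) :
    R.coordVec (prodChart h Φ c) (euclideanProdEquiv h z) (euclideanProdEquiv h ξ)
      = mfderiv (𝓘(ℝ, EuclideanSpace ℝ (Fin k)).prod 𝓘(ℝ, EuclideanSpace ℝ (Fin l)))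
        𝓘(ℝ, EuclideanSpace ℝ (Fin n)) Φ (c.symm z.1, z.2) (M.coordVec c z.1 ξ.1, ξ.2) := by
  set A := euclideanFst h
  set B := euclideanSnd h
  have hAz : A (euclideanProdEquiv h z) = z.1 := euclideanFst_apply h z
  have hBz : B (euclideanProdEquiv h z) = z.2 := euclideanSnd_apply h z
  have h1 := (hasMFDerivAt_of_eq (((contMDiffOn_symm_of_mem_maximalAtlas hc).contMDiffAt
    (c.open_target.mem_nhds hz)).mdifferentiableAt (by simp)) hAz).comp (euclideanProdEquiv h z)
      A.hasMFDerivAt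
  have h2 := h1.prodMk B.hasMFDerivAt
  have h3 := (hasMFDerivAt_of_eq (y := (c.symm (A (euclideanProdEquiv h z)),
    B (euclideanProdEquiv h z))) ((hΦ.smooth.contMDiffAt
    (Φ.open_source.mem_nhds hzs)).mdifferentiableAt (by simp)) (by rw [hAz, hBz])).comp
      (euclideanProdEquiv h z) h2
  have h4 : ((prodChart h Φ c).symm : EuclideanSpace ℝ (Fin n) → R.carrier)
      = Φ ∘ fun y => (c.symm (A y), B y) := rfl
  unfold coordVec
  rw [h4]
  erw [h3.mfderiv]
  change (mfderiv (𝓘(ℝ, EuclideanSpace ℝ (Fin k)).prod 𝓘(ℝ, EuclideanSpace ℝ (Fin l)))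
    𝓘(ℝ, EuclideanSpace ℝ (Fin n)) Φ (c.symm z.1, z.2))
    (M.coordVec c z.1 (A (euclideanProdEquiv h ξ)), B (euclideanProdEquiv h ξ)) = _
  rw [show A (euclideanProdEquiv h ξ) = ξ.1 from euclideanFst_apply h ξ,
    show B (euclideanProdEquiv h ξ) = ξ.2 from euclideanSnd_apply h ξ]
  rfl

/-- The right side is the determinant of `κ` times the block diagonal matrix of the model metric,
whose quadratic form dominates that of `R` by `MetricLE`. Only an upper bound on the measure is
needed later. -/
theorem gram_prodChart_le (h : k + l = n) (hΦ : IsSmoothParam Φ)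
    {c : OpenPartialHomeomorph M.carrier (EuclideanSpace ℝ (Fin k))}
    (hc : c ∈ IsManifold.maximalAtlas 𝓘(ℝ, EuclideanSpace ℝ (Fin k)) ∞ M.carrier)
    {z : EuclideanSpace ℝ (Fin k) × EuclideanSpace ℝ (Fin l)} (hz : z.1 ∈ c.target)
    (hzs : (c.symm z.1, z.2) ∈ Φ.source) {κ H : ℝ} (hm : MetricLE Φ κ H (c.symm z.1, z.2)) :
    (R.gram (prodChart h Φ c) (euclideanProdEquiv h z)).det
      ≤ κ ^ n * ((M.gram c z.1).det * H ^ l) := by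
  set σ := finSumFinEquiv.trans (finCongr h) with hσ
  have hB : κ ^ n * ((M.gram c z.1).det * H ^ l)
      = (κ • reindex σ σ (fromBlocks (M.gram c z.1) 0 0 (H • (1 : Matrix (Fin l) (Fin l) ℝ)))).det := by
    rw [det_smul, det_reindex_self, det_fromBlocks_zero₁₂, det_smul]
    simp
  rw [hB]
  refine (R.gram_posSemidef _ _).det_le_det ?_ fun x => ?_
  · have h1 : (fromBlocks (M.gram c z.1) 0 0 (H • (1 : Matrix (Fin l) (Fin l) ℝ))).IsHermitian := by
      refine IsHermitian.fromBlocks (M.gram_posSemidef c z.1).1 (by simp) ?_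
      unfold IsHermitian
      simp
    unfold IsHermitian
    rw [conjTranspose_smul, conjTranspose_reindex, h1.eq, star_trivial]
  · obtain ⟨ξ, hξ⟩ := (euclideanProdEquiv h).surjective (WithLp.toLp 2 x)
    have hx : x = (euclideanProdEquiv h ξ).ofLp := by rw [hξ]
    have hxσ : x ∘ σ = Sum.elim ξ.1.ofLp ξ.2.ofLp :=
      funext fun i => by rw [hx]; exact euclideanProdEquiv_apply h ξ i
    have hright : x ⬝ᵥ ((κ • reindex σ σ (fromBlocks (M.gram c z.1) 0 0
        (H • (1 : Matrix (Fin l) (Fin l) ℝ)))) *ᵥ x)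
        = κ * (ξ.1.ofLp ⬝ᵥ (M.gram c z.1 *ᵥ ξ.1.ofLp) + H * ‖ξ.2‖ ^ 2) := by
      rw [smul_mulVec, dotProduct_smul, reindex_apply, submatrix_mulVec_equiv]
      simp only [Equiv.symm_symm, hxσ]
      rw [← comp_equiv_dotProduct_comp_equiv x _ σ, hxσ, Function.comp_assoc]
      have hn : ξ.2.ofLp ⬝ᵥ ξ.2.ofLp = ‖ξ.2‖ ^ 2 := by
        rw [EuclideanSpace.real_norm_sq_eq]
        simp [dotProduct, sq]
      rw [← hn]
      simp [fromBlocks_mulVec, smul_mulVec]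
    rw [hright, M.gram_quadForm]
    conv_lhs => rw [hx]
    rw [R.gram_quadForm, coordVec_prodChart h hΦ hc hz hzs ξ]
    have := hm (M.coordVec c z.1 ξ.1) ξ.2
    rwa [← prodChart_symm_apply h c z] at this

end RiemMfd

/-! ### Upper bounds for the measure of product regions -/

theorem OpenPartialHomeomorph.measurableSet_image {α β : Type*} [TopologicalSpace α]
    [TopologicalSpace β] [MeasurableSpace α] [MeasurableSpace β] [OpensMeasurableSpace α]
    [BorelSpace α] [BorelSpace β] (e : OpenPartialHomeomorph α β) {s : Set α} (hs : MeasurableSet s)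
    (hse : s ⊆ e.source) : MeasurableSet (e '' s) := by
  have h : e '' s = e.target ∩ e.symm ⁻¹' s := by
    rw [← inter_eq_self_of_subset_right hse, e.image_source_inter_eq',
      inter_eq_self_of_subset_right hse]
  rw [h, ← Subtype.image_preimage_coe]
  refine e.open_target.measurableSet.subtype_image ?_
  exact (continuousOn_iff_continuous_domRestrict.1 e.continuousOn_symm).measurable hs

namespace RiemMfd

open Matrix

variable {n k l : ℕ} {R : RiemMfd.{u} n} {M : RiemMfd.{u} k}
  {Φ : OpenPartialHomeomorph (M.carrier × EuclideanSpace ℝ (Fin l)) R.carrier}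

theorem image_prodChart (h : k + l = n)
    (c : OpenPartialHomeomorph M.carrier (EuclideanSpace ℝ (Fin k))) {A : Set M.carrier}
    {B : Set (EuclideanSpace ℝ (Fin l))} (hs : A ×ˢ B ⊆ Φ.source) :
    prodChart h Φ c '' (Φ '' (A ×ˢ B)) = euclideanProdEquiv h '' ((c '' A) ×ˢ B) := by
  rw [image_image]
  have : EqOn (fun z => prodChart h Φ c (Φ z)) (fun z => euclideanProdEquiv h (c z.1, z.2))
      (A ×ˢ B) := fun z hz => by
    simp [prodChart, Φ.left_inv (hs hz)]
  have h2 : (c '' A) ×ˢ B = Prod.map c id '' (A ×ˢ B) := by rw [prodMap_image_prod, image_id]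
  rw [this.image_eq, h2, image_image]
  rfl

/-- The measure, in the region of `R` parametrized by `A × B`, where `A` lies in a chart of `M`. -/
theorem IsWeightedVolume.image_prod_le_of_chart (h : k + l = n) (hΦ : IsSmoothParam Φ)
    {w : R.carrier → ℝ} {μ : Measure R.carrier} (hμ : R.IsWeightedVolume w μ)
    {ν : Measure M.carrier} (hν : M.IsWeightedVolume (fun _ => 1) ν)
    {c : OpenPartialHomeomorph M.carrier (EuclideanSpace ℝ (Fin k))}
    (hc : c ∈ IsManifold.maximalAtlas 𝓘(ℝ, EuclideanSpace ℝ (Fin k)) ∞ M.carrier)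
    {A : Set M.carrier} (hA : MeasurableSet A) (hAc : A ⊆ c.source)
    {B : Set (EuclideanSpace ℝ (Fin l))} (hB : MeasurableSet B) (hs : A ×ˢ B ⊆ Φ.source)
    {κ : ℝ} {H W G : EuclideanSpace ℝ (Fin l) → ℝ}
    (hm : ∀ a ∈ A, ∀ y ∈ B, MetricLE Φ κ (H y) (a, y))
    (hw : ∀ a ∈ A, ∀ y ∈ B, w (Φ (a, y)) ≤ W y) (hW : ∀ y ∈ B, 0 ≤ W y)
    (hG : ∀ y ∈ B, W y * √(κ ^ n * H y ^ l) ≤ G y) (hGm : Measurable G)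
    (hfin : ∫⁻ y in B, ENNReal.ofReal (G y) ≠ ⊤) :
    μ (Φ '' (A ×ˢ B)) ≤ ν A * ∫⁻ y in B, ENNReal.ofReal (G y) := by
  have hmeas : MeasurableSet (Φ '' (A ×ˢ B)) := Φ.measurableSet_image (hA.prod hB) hs
  have hsub : Φ '' (A ×ˢ B) ⊆ (prodChart h Φ c).source := by
    rintro _ ⟨z, hz, rfl⟩
    have hz' := hs hz
    simp [prodChart, Φ.map_source hz', Φ.left_inv hz', hAc hz.1]
  have hcA : MeasurableSet (c '' A) := c.measurableSet_image hA hAc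
  rw [hμ _ (prodChart_mem_maximalAtlas h hΦ hc) _ hmeas hsub, image_prodChart h c hs,
    ← (measurePreserving_euclideanProdEquiv h).setLIntegral_comp_emb
      (euclideanProdEquiv h).toHomeomorph.measurableEmbedding,
    hν c hc A hA hAc]
  have hpt : ∀ z ∈ (c '' A) ×ˢ B, ENNReal.ofReal
      (w ((prodChart h Φ c).symm (euclideanProdEquiv h z))
        * √(R.gram (prodChart h Φ c) (euclideanProdEquiv h z)).det)
      ≤ ENNReal.ofReal (1 * √(M.gram c z.1).det) * ENNReal.ofReal (G z.2) := by
    rintro ⟨x, y⟩ ⟨⟨a, ha, rfl⟩, hy⟩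
    have hca : c.symm (c a) = a := c.left_inv (hAc ha)
    have hsrc : (c.symm (c a), y) ∈ Φ.source := by rw [hca]; exact hs ⟨ha, hy⟩
    have hdet := gram_prodChart_le h hΦ hc (z := (c a, y)) (c.map_source (hAc ha)) hsrc
      (κ := κ) (H := H y) (by rw [hca]; exact hm a ha y hy)
    rw [← ENNReal.ofReal_mul (by positivity)]
    refine ENNReal.ofReal_le_ofReal ?_
    rw [prodChart_symm_apply, hca]
    calc w (Φ (a, y)) * √(R.gram (prodChart h Φ c) (euclideanProdEquiv h (c a, y))).det
        ≤ W y * √((M.gram c (c a)).det * (κ ^ n * H y ^ l)) := by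
          refine mul_le_mul (hw a ha y hy) (Real.sqrt_le_sqrt (hdet.trans_eq (by ring)))
            (Real.sqrt_nonneg _) (hW y hy)
      _ = √(M.gram c (c a)).det * (W y * √(κ ^ n * H y ^ l)) := by
          rw [Real.sqrt_mul (M.gram_posSemidef c _).det_nonneg]
          ring
      _ ≤ 1 * √(M.gram c (c a)).det * G y := by
          rw [one_mul]
          exact mul_le_mul_of_nonneg_left (hG y hy) (Real.sqrt_nonneg _)
  refine (setLIntegral_mono' (hcA.prod hB) hpt).trans ?_
  rw [Measure.volume_eq_prod, ← Measure.prod_restrict]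
  -- This half of Tonelli needs no measurability of the Gram determinant; finiteness of the
  -- `y`-integral (`hfin`) likewise replaces it when that factor is pulled out of the outer
  -- integral.
  refine (lintegral_prod_le _).trans ?_
  simp only
  rw [← lintegral_mul_const' _ _ hfin]
  refine lintegral_mono fun x => ?_
  rw [lintegral_const_mul _ hGm.ennreal_ofReal]

/-- The measure, in the region of `R` parametrized by `M × B`. -/
theorem IsWeightedVolume.image_prod_le (h : k + l = n) (hΦ : IsSmoothParam Φ)
    {w : R.carrier → ℝ} {μ : Measure R.carrier} (hμ : R.IsWeightedVolume w μ)
    {ν : Measure M.carrier} (hν : M.IsWeightedVolume (fun _ => 1) ν)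
    {B : Set (EuclideanSpace ℝ (Fin l))} (hB : MeasurableSet B) (hs : univ ×ˢ B ⊆ Φ.source)
    {κ : ℝ} {H W G : EuclideanSpace ℝ (Fin l) → ℝ}
    (hm : ∀ a, ∀ y ∈ B, MetricLE Φ κ (H y) (a, y))
    (hw : ∀ a, ∀ y ∈ B, w (Φ (a, y)) ≤ W y) (hW : ∀ y ∈ B, 0 ≤ W y)
    (hG : ∀ y ∈ B, W y * √(κ ^ n * H y ^ l) ≤ G y) (hGm : Measurable G)
    (hfin : ∫⁻ y in B, ENNReal.ofReal (G y) ≠ ⊤) :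
    μ (Φ '' (univ ×ˢ B)) ≤ ν univ * ∫⁻ y in B, ENNReal.ofReal (G y) := by
  -- Countably many chart domains cover `M`; making them disjoint lets their volumes add up exactly
  -- to `ν univ`.
  obtain ⟨T, hT, hcov⟩ := TopologicalSpace.countable_cover_nhds
    (fun a : M.carrier => chart_source_mem_nhds (EuclideanSpace ℝ (Fin k)) a)
  rcases isEmpty_or_nonempty M.carrier with hemp | hne
  · simp [univ_eq_empty_iff.2 hemp]
  have hTne : T.Nonempty := by
    obtain ⟨a⟩ := hne
    have : a ∈ ⋃ x ∈ T, (chartAt (EuclideanSpace ℝ (Fin k)) x).source := hcov ▸ mem_univ a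
    simp only [mem_iUnion] at this
    exact ⟨_, this.choose_spec.choose⟩
  obtain ⟨a, rfl⟩ := hT.exists_eq_range hTne
  set S : ℕ → Set M.carrier := fun i => (chartAt (EuclideanSpace ℝ (Fin k)) (a i)).source with hS
  have hSm : ∀ i, MeasurableSet (S i) := fun i =>
    (chartAt (EuclideanSpace ℝ (Fin k)) (a i)).open_source.measurableSet
  have huniv : ⋃ i, disjointed S i = univ := by
    rw [iUnion_disjointed, ← hcov]
    simp [hS]
  have hdm : ∀ i, MeasurableSet (disjointed S i) := MeasurableSet.disjointed hSm
  have himg : Φ '' (univ ×ˢ B) = ⋃ i, Φ '' (disjointed S i ×ˢ B) := by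
    rw [← image_iUnion, ← iUnion_prod_const, huniv]
  calc μ (Φ '' (univ ×ˢ B)) ≤ ∑' i, μ (Φ '' (disjointed S i ×ˢ B)) := by
        rw [himg]
        exact measure_iUnion_le _
    _ ≤ ∑' i, ν (disjointed S i) * ∫⁻ y in B, ENNReal.ofReal (G y) := by
        refine ENNReal.tsum_le_tsum fun i => ?_
        exact hμ.image_prod_le_of_chart h hΦ hν (IsManifold.chart_mem_maximalAtlas (a i)) (hdm i)
          (disjointed_subset S i) hB ((prod_mono (subset_univ _) le_rfl).trans hs)
          (fun a _ => hm a) (fun a _ => hw a) hW hG hGm hfin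
    _ = ν univ * ∫⁻ y in B, ENNReal.ofReal (G y) := by
        rw [ENNReal.tsum_mul_right, ← measure_iUnion (disjoint_disjointed S) hdm, huniv]

end RiemMfd

/-! ### The harmonic function -/

theorem braneH_of_eq {p : ℕ} (hp : p = 7) (gs r₀ r : ℝ) :
    braneH p gs r₀ r = (2 * Real.pi / gs) * Real.log (r₀ / r) := by
  rw [braneH, if_pos hp, ← inv_div r₀ r, Real.log_inv]
  ring

theorem braneH_of_ne {p : ℕ} (hp : p ≠ 7) (gs r₀ r : ℝ) :
    braneH p gs r₀ r = (r₀ / r) ^ (7 - p) := by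
  rw [braneH, if_neg hp]

/-- For `p = 7` the function is positive only for `r < r₀`; below `r₀ / e` the logarithm is at least
`1`. Otherwise `r₀ / r ≥ 1` suffices. -/
theorem exists_le_braneH (p : ℕ) {gs r₀ : ℝ} (hgs : 0 < gs) (hr₀ : 0 < r₀) :
    ∃ c > 0, ∃ δ > 0, ∀ r, 0 < r → r < δ → c ≤ braneH p gs r₀ r := by
  by_cases hp : p = 7
  · refine ⟨2 * Real.pi / gs, by positivity, r₀ / Real.exp 1, by positivity, fun r hr hrδ => ?_⟩
    rw [braneH_of_eq hp]
    refine le_mul_of_one_le_right (by positivity) ?_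
    rw [Real.le_log_iff_exp_le (by positivity), le_div_iff₀ hr, mul_comm]
    exact ((lt_div_iff₀ (Real.exp_pos 1)).1 hrδ).le
  · refine ⟨1, one_pos, r₀, hr₀, fun r hr hrδ => ?_⟩
    rw [braneH_of_ne hp]
    exact one_le_pow₀ ((one_le_div hr).2 hrδ.le)

/-- The exponent `7 - p` is at least `2`, so the radial length element `√H dr` dominates `r₀ dr /
r`, which has infinite integral at `0`. -/
theorem exists_le_mul_sqrt_braneH {p : ℕ} (hp : p ≤ 5) (gs : ℝ) {r₀ : ℝ} (hr₀ : 0 < r₀) :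
    ∃ δ > 0, ∀ r, 0 < r → r < δ → r₀ ≤ r * √(braneH p gs r₀ r) := by
  refine ⟨r₀, hr₀, fun r hr hrδ => ?_⟩
  have h1 : 1 ≤ r₀ / r := (one_le_div hr).2 hrδ.le
  have h2 : (r₀ / r) ^ 2 ≤ braneH p gs r₀ r := by
    rw [braneH_of_ne (by omega)]
    exact pow_le_pow_right₀ h1 (by omega)
  calc r₀ = r * √((r₀ / r) ^ 2) := by
        rw [Real.sqrt_sq (by positivity)]
        field_simp
    _ ≤ r * √(braneH p gs r₀ r) := by gcongr

/-- The crude bound `log t ≤ t` is enough for `p = 7`, because `1 / r` is already integrable near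
`0` in dimension `9 - p ≥ 2`. -/
theorem exists_braneH_le {p : ℕ} (hp : p = 6 ∨ p = 7) {gs r₀ : ℝ} (hgs : 0 < gs) (hr₀ : 0 < r₀) :
    ∃ C > 0, ∀ r, 0 < r → braneH p gs r₀ r ≤ C * r⁻¹ := by
  rcases hp with rfl | rfl
  · refine ⟨r₀, hr₀, fun r hr => ?_⟩
    rw [braneH_of_ne (by norm_num)]
    simp [div_eq_mul_inv]
  · refine ⟨2 * Real.pi / gs * r₀, by positivity, fun r hr => ?_⟩
    rw [braneH_of_eq rfl, mul_assoc, ← div_eq_mul_inv]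
    gcongr
    exact Real.log_le_self (by positivity)

theorem continuousAt_braneH (p : ℕ) (gs : ℝ) {r₀ r : ℝ} (hr₀ : 0 < r₀) (hr : 0 < r) :
    ContinuousAt (braneH p gs r₀) r := by
  have h : ContinuousAt (fun r => r₀ / r) r := continuousAt_const.div continuousAt_id hr.ne'
  by_cases hp : p = 7
  · rw [funext (braneH_of_eq hp gs r₀)]
    exact continuousAt_const.mul (h.log (by positivity))
  · rw [funext (braneH_of_ne hp gs r₀)]
    exact h.pow _

theorem measurable_braneH (p : ℕ) (gs r₀ : ℝ) : Measurable (braneH p gs r₀) := by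
  by_cases hp : p = 7
  · rw [funext (braneH_of_eq hp gs r₀)]
    exact (Real.measurable_log.comp (measurable_const.div measurable_id)).const_mul _
  · rw [funext (braneH_of_ne hp gs r₀)]
    exact (measurable_const.div measurable_id).pow_const _

/-! ### Logarithmic cutoff functions on a punctured ball -/

theorem exists_abs_deriv_smoothTransition_le :
    ∃ C > 0, ∀ t, |deriv Real.smoothTransition t| ≤ C := by
  have hc : Continuous (deriv Real.smoothTransition) :=
    (Real.smoothTransition.contDiff (n := 1)).continuous_deriv le_rfl
  have hs : HasCompactSupport (deriv Real.smoothTransition) := by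
    refine HasCompactSupport.intro (isCompact_Icc (a := (0 : ℝ)) (b := 1)) fun t ht => ?_
    by_cases h0 : t < 0
    · have : Real.smoothTransition =ᶠ[𝓝 t] fun _ => 0 := by
        filter_upwards [Iio_mem_nhds h0] with s hs using Real.smoothTransition.zero_of_nonpos hs.le
      rw [this.deriv_eq]
      simp
    · have h1 : 1 < t := by
        by_contra h1
        exact ht ⟨not_lt.1 h0, not_lt.1 h1⟩
      have : Real.smoothTransition =ᶠ[𝓝 t] fun _ => 1 := by
        filter_upwards [Ioi_mem_nhds h1] with s hs using Real.smoothTransition.one_of_one_le hs.le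
      rw [this.deriv_eq]
      simp
  obtain ⟨C, hC⟩ := hs.exists_bound_of_continuous hc
  exact ⟨max C 1, by positivity, fun t => (hC t).trans (le_max_left _ _)⟩

/-- A bound for the derivative of `Real.smoothTransition`. -/
def transitionBound : ℝ := exists_abs_deriv_smoothTransition_le.choose

theorem transitionBound_pos : 0 < transitionBound :=
  exists_abs_deriv_smoothTransition_le.choose_spec.1

theorem abs_deriv_smoothTransition_le (t : ℝ) :
    |deriv Real.smoothTransition t| ≤ transitionBound :=
  exists_abs_deriv_smoothTransition_le.choose_spec.2 t

/-- The logarithmic cutoff: it is `1` for `0 < r ≤ ρ e^{-L}`, and `0` for `r ≥ ρ` and `r = 0`. -/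
def logCutoff (ρ L r : ℝ) : ℝ := Real.smoothTransition (Real.log (ρ / r) / L)

theorem logCutoff_nonneg (ρ L r : ℝ) : 0 ≤ logCutoff ρ L r := Real.smoothTransition.nonneg _

theorem logCutoff_le_one (ρ L r : ℝ) : logCutoff ρ L r ≤ 1 := Real.smoothTransition.le_one _

/-- The conventions `ρ / 0 = 0` and `log 0 = 0` give `0`, not the limit `1`. This is wanted: `0` is
the default transverse coordinate off the end, where the cutoff must vanish. -/
theorem logCutoff_zero (ρ L : ℝ) : logCutoff ρ L 0 = 0 := by
  simp [logCutoff]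

theorem logCutoff_of_le {ρ L r : ℝ} (hρ : 0 < ρ) (hL : 0 < L) (hr : ρ ≤ r) :
    logCutoff ρ L r = 0 := by
  refine Real.smoothTransition.zero_of_nonpos (div_nonpos_of_nonpos_of_nonneg ?_ hL.le)
  have hr0 : 0 < r := hρ.trans_le hr
  exact Real.log_nonpos (by positivity) ((div_le_one hr0).2 hr)

theorem logCutoff_of_le_exp {ρ L r : ℝ} (hL : 0 < L) (hr0 : 0 < r)
    (hr : r ≤ ρ * Real.exp (-L)) : logCutoff ρ L r = 1 := by
  refine Real.smoothTransition.one_of_one_le ((one_le_div hL).2 ?_)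
  have hρ : 0 < ρ := pos_of_mul_pos_left (hr0.trans_le hr) (Real.exp_pos _).le
  rw [Real.le_log_iff_exp_le (by positivity), le_div_iff₀ hr0]
  rw [Real.exp_neg] at hr
  have := Real.exp_pos L
  field_simp at hr
  linarith

theorem tendsto_logCutoff (ρ r : ℝ) : Tendsto (fun L => logCutoff ρ L r) atTop (𝓝 0) := by
  have h : Tendsto (fun L => Real.log (ρ / r) / L) atTop (𝓝 0) :=
    tendsto_const_nhds.div_atTop tendsto_id
  simpa [logCutoff, Function.comp_def] using
    (Real.smoothTransition.continuous.tendsto 0).comp h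

theorem measurable_logCutoff (ρ L : ℝ) : Measurable (logCutoff ρ L) :=
  Real.smoothTransition.continuous.measurable.comp
    ((Real.measurable_log.comp (measurable_const.div measurable_id)).div_const _)

theorem contDiffAt_logCutoff {ρ L r : ℝ} (hρ : 0 < ρ) (hr : 0 < r) :
    ContDiffAt ℝ 1 (logCutoff ρ L) r := by
  refine (Real.smoothTransition.contDiff (n := 1)).contDiffAt.comp r ?_
  exact ((contDiffAt_const.div contDiffAt_id hr.ne').log (div_pos hρ hr).ne').div_const _

theorem abs_deriv_logCutoff_le {ρ L r : ℝ} (hρ : 0 < ρ) (hL : 0 < L) (hr : 0 < r) :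
    |deriv (logCutoff ρ L) r| ≤ transitionBound / (L * r) := by
  have h1 : HasDerivAt (fun r => Real.log (ρ / r) / L) (-1 / (L * r)) r := by
    have := (((hasDerivAt_const r ρ).div (hasDerivAt_id r) hr.ne').log
      (div_pos hρ hr).ne').div_const L
    refine this.congr_deriv ?_
    simp only [Pi.div_apply, id]
    field_simp
    simp
  have h2 := ((Real.smoothTransition.contDiff (n := 1)).differentiable one_ne_zero
    (Real.log (ρ / r) / L)).hasDerivAt.comp r h1
  have h3 : deriv (logCutoff ρ L) r = _ := h2.deriv
  rw [h3, abs_mul, abs_div, abs_neg, abs_one, abs_of_pos (mul_pos hL hr), mul_one_div]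
  gcongr
  exact abs_deriv_smoothTransition_le _

theorem deriv_logCutoff_eq_zero {ρ L r : ℝ} (hρ : 0 < ρ) (hL : 0 < L) (hr : 0 < r)
    (h : ¬(ρ * Real.exp (-L) ≤ r ∧ r ≤ ρ)) : deriv (logCutoff ρ L) r = 0 := by
  by_cases h1 : ρ < r
  · have : logCutoff ρ L =ᶠ[𝓝 r] fun _ => 0 := by
      filter_upwards [Ioi_mem_nhds h1] with s hs using logCutoff_of_le hρ hL hs.le
    rw [this.deriv_eq]
    simp
  · have h2 : r < ρ * Real.exp (-L) := by
      by_contra h2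
      exact h ⟨not_lt.1 h2, not_lt.1 h1⟩
    have : logCutoff ρ L =ᶠ[𝓝 r] fun _ => 1 := by
      filter_upwards [Ioo_mem_nhds hr h2] with s hs using logCutoff_of_le_exp hL hs.1 hs.2.le
    rw [this.deriv_eq]
    simp

theorem contDiffAt_logCutoff_norm {F : Type*} [NormedAddCommGroup F] [InnerProductSpace ℝ F]
    {ρ L : ℝ} (hρ : 0 < ρ) {y : F} (hy : y ≠ 0) :
    ContDiffAt ℝ 1 (fun y : F => logCutoff ρ L ‖y‖) y :=
  (contDiffAt_logCutoff hρ (norm_pos_iff.2 hy)).comp y (contDiffAt_norm ℝ hy)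

theorem abs_fderiv_logCutoff_norm_le {F : Type*} [NormedAddCommGroup F] [InnerProductSpace ℝ F]
    {ρ L : ℝ} (hρ : 0 < ρ) {y : F} (hy : y ≠ 0) (w : F) :
    |fderiv ℝ (fun y : F => logCutoff ρ L ‖y‖) y w| ≤ |deriv (logCutoff ρ L) ‖y‖| * ‖w‖ := by
  have h1 := ((contDiffAt_logCutoff (L := L) hρ (norm_pos_iff.2 hy)).differentiableAt
    one_ne_zero).hasDerivAt.comp_hasFDerivAt y
    ((contDiffAt_norm ℝ hy (n := 1)).differentiableAt one_ne_zero).hasFDerivAt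
  have h2 : fderiv ℝ (fun y : F => logCutoff ρ L ‖y‖) y = _ := h1.fderiv
  rw [h2, _root_.smul_apply, smul_eq_mul, abs_mul]
  refine mul_le_mul_of_nonneg_left ?_ (abs_nonneg _)
  have h3 : ‖fderiv ℝ (fun y : F => ‖y‖) y‖ ≤ 1 := by
    simpa using norm_fderiv_le_of_lipschitz ℝ (x₀ := y) (lipschitzWith_one_norm (E := F))
  exact (ContinuousLinearMap.le_of_opNorm_le _ h3 w).trans_eq (one_mul _)

/-! ### Cutoffs on a single end -/

namespace DpEnd

open RiemMfd

variable {p d n : ℕ} {R : RiemMfd.{u} n} {f : R.carrier → ℝ} (E : DpEnd p d R f)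

theorem isSmoothParam : IsSmoothParam E.Φ := ⟨E.smooth_Φ, E.smooth_symm⟩

/-- The harmonic function of the end. -/
def H (r : ℝ) : ℝ := braneH p E.gs E.r₀ r

/-- The region `{0 < r < ρ}` of an end where the asymptotics are effective. -/
structure Controlled (ρ : ℝ) : Prop where
  pos : 0 < ρ
  lt_eps : ρ < E.ε
  H_bound : ∃ c > 0, ∀ r, 0 < r → r ≤ ρ → c ≤ E.H r
  mul_sqrt_H_bound : p ≤ 5 → ∃ c > 0, ∀ r, 0 < r → r ≤ ρ → c ≤ r * √(E.H r)
  le_metric : ∀ a y, 0 < ‖y‖ → ‖y‖ ≤ ρ →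
    ∀ (v : TangentSpace 𝓘(ℝ, EuclideanSpace ℝ (Fin (p + 1 - d))) a)
      (w : EuclideanSpace ℝ (Fin (9 - p))),
      E.H ‖y‖ * ‖w‖ ^ 2 / 2 ≤ R.metric.inner (E.Φ (a, y))
          (mfderiv
            (𝓘(ℝ, EuclideanSpace ℝ (Fin (p + 1 - d))).prod 𝓘(ℝ, EuclideanSpace ℝ (Fin (9 - p))))
            𝓘(ℝ, EuclideanSpace ℝ (Fin n)) E.Φ (a, y) (v, w))
          (mfderiv
            (𝓘(ℝ, EuclideanSpace ℝ (Fin (p + 1 - d))).prod 𝓘(ℝ, EuclideanSpace ℝ (Fin (9 - p))))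
            𝓘(ℝ, EuclideanSpace ℝ (Fin n)) E.Φ (a, y) (v, w))
  metric_le : ∀ a y, 0 < ‖y‖ → ‖y‖ ≤ ρ → MetricLE E.Φ 2 (E.H ‖y‖) (a, y)
  weight_le : ∀ a y, 0 < ‖y‖ → ‖y‖ ≤ ρ →
    Real.exp (f (E.Φ (a, y))) ≤ 2 * E.H ‖y‖ ^ (((p : ℝ) - 7) / 2)

/-- The eventual form allows a common `ρ` for the finitely many ends. -/
theorem eventually_controlled : ∀ᶠ ρ in 𝓝[>] (0 : ℝ), E.Controlled ρ := by
  obtain ⟨c, hc, δ₀, hδ₀, hH⟩ := exists_le_braneH p E.gs_pos E.r₀_pos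
  -- Relative error `1/2` keeps the metric between `1/2` and `3/2 ≤ 2` times the model; relative
  -- error `1` keeps the weight below twice the model.
  obtain ⟨δ₁, hδ₁, hm⟩ := E.metric_asymptotic (1 / 2) (by norm_num)
  obtain ⟨δ₂, hδ₂, hw⟩ := E.weight_asymptotic 1 one_pos
  have hmin : 0 < min E.ε (min δ₀ (min δ₁ δ₂)) := by
    simp [E.ε_pos, hδ₀, hδ₁, hδ₂]
  have hsmall : ∀ᶠ ρ in 𝓝[>] (0 : ℝ), p ≤ 5 →
      ∃ c > 0, ∀ r, 0 < r → r ≤ ρ → c ≤ r * √(E.H r) := by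
    by_cases hp : p ≤ 5
    · obtain ⟨δ, hδ, h⟩ := exists_le_mul_sqrt_braneH hp E.gs E.r₀_pos
      filter_upwards [Ioo_mem_nhdsGT hδ] with ρ hρ _
      exact ⟨E.r₀, E.r₀_pos, fun r hr hrρ => h r hr (hrρ.trans_lt hρ.2)⟩
    · exact Eventually.of_forall fun ρ h => absurd h hp
  filter_upwards [Ioo_mem_nhdsGT hmin, hsmall] with ρ hρ hρ5
  simp only [mem_Ioo, lt_min_iff] at hρ
  obtain ⟨hρ0, hρε, hρ₀, hρ₁, hρ₂⟩ := hρ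
  refine ⟨hρ0, hρε, ⟨c, hc, fun r hr hrρ => hH r hr (hrρ.trans_lt hρ₀)⟩, hρ5, ?_, ?_, ?_⟩
  · intro a y hy hyρ v w
    have h1 := (abs_le.1 (hm a y hy (hyρ.trans_lt hρε) (hyρ.trans_lt hρ₁) v w)).1
    have h2 := E.M.inner_self_nonneg v
    change E.H ‖y‖ * ‖w‖ ^ 2 / 2 ≤ _
    unfold H
    linarith
  · intro a y hy hyρ v w
    have h1 := (abs_le.1 (hm a y hy (hyρ.trans_lt hρε) (hyρ.trans_lt hρ₁) v w)).2
    have h2 := E.M.inner_self_nonneg v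
    have h3 : 0 ≤ braneH p E.gs E.r₀ ‖y‖ := hc.le.trans (hH _ hy (hyρ.trans_lt hρ₀))
    have h4 : 0 ≤ braneH p E.gs E.r₀ ‖y‖ * ‖w‖ ^ 2 := by positivity
    unfold H
    linarith
  · intro a y hy hyρ
    have h1 := (abs_le.1 (hw a y hy (hyρ.trans_lt hρε) (hyρ.trans_lt hρ₂))).2
    unfold H
    linarith

variable {E} in
theorem Controlled.H_pos {ρ : ℝ} (hE : E.Controlled ρ) {r : ℝ} (hr : 0 < r) (hrρ : r ≤ ρ) :
    0 < E.H r := by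
  obtain ⟨c, hc, h⟩ := hE.H_bound
  exact hc.trans_le (h r hr hrρ)

/-! ### The transverse coordinate -/

/-- The transverse coordinate `y` of a point in the end, extended by `0`. -/
def trans (x : R.carrier) : EuclideanSpace ℝ (Fin (9 - p)) :=
  E.Φ.target.indicator (fun x => (E.Φ.symm x).2) x

theorem trans_of_mem {x : R.carrier} (hx : x ∈ E.Φ.target) : E.trans x = (E.Φ.symm x).2 :=
  indicator_of_mem hx _

theorem trans_of_notMem {x : R.carrier} (hx : x ∉ E.Φ.target) : E.trans x = 0 :=
  indicator_of_notMem hx _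

theorem trans_ne_zero {x : R.carrier} (hx : x ∈ E.Φ.target) : E.trans x ≠ 0 := by
  rw [E.trans_of_mem hx, ← norm_pos_iff]
  have := E.Φ.map_target hx
  rw [E.source_eq] at this
  exact this.1

theorem trans_param {z : E.M.carrier × EuclideanSpace ℝ (Fin (9 - p))} (hz : z ∈ E.Φ.source) :
    E.trans (E.Φ z) = z.2 := by
  rw [E.trans_of_mem (E.Φ.map_source hz), E.Φ.left_inv hz]

theorem continuousAt_trans {x : R.carrier} (hx : x ∈ E.Φ.target) : ContinuousAt E.trans x := by
  have h : ContinuousAt (fun x => (E.Φ.symm x).2) x := (E.Φ.continuousAt_symm hx).snd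
  refine h.congr ?_
  filter_upwards [E.Φ.open_target.mem_nhds hx] with y hy using (E.trans_of_mem hy).symm

theorem measurable_trans : Measurable E.trans := by
  refine measurable_of_restrict_of_restrict_compl E.Φ.open_target.measurableSet ?_ ?_
  · refine Continuous.measurable (continuousOn_iff_continuous_domRestrict.1 ?_)
    exact fun x hx => (E.continuousAt_trans hx).continuousWithinAt
  · have : E.Φ.targetᶜ.domRestrict E.trans = fun _ => 0 := funext fun x => E.trans_of_notMem x.2
    rw [this]
    exact measurable_const

/-- The set `B` has to avoid `0`, the default value of `trans` off the end. -/
theorem preimage_trans {B : Set (EuclideanSpace ℝ (Fin (9 - p)))}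
    (hB : ∀ y ∈ B, 0 < ‖y‖ ∧ ‖y‖ < E.ε) : E.trans ⁻¹' B = E.Φ '' (univ ×ˢ B) := by
  ext x
  constructor
  · intro hx
    have hxt : x ∈ E.Φ.target := by
      by_contra h
      have := (hB _ hx).1
      rw [E.trans_of_notMem h] at this
      simp at this
    refine ⟨E.Φ.symm x, ⟨mem_univ _, ?_⟩, E.Φ.right_inv hxt⟩
    rw [← E.trans_of_mem hxt]
    exact hx
  · rintro ⟨z, hz, rfl⟩
    change E.trans (E.Φ z) ∈ B
    rw [E.trans_param (by rw [E.source_eq]; exact hB _ hz.2)]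
    exact hz.2

/-! ### The cutoff functions of the end -/

/-- The logarithmic cutoff function of the end. -/
def cutoff (ρ L : ℝ) (x : R.carrier) : ℝ := logCutoff ρ L ‖E.trans x‖

theorem cutoff_nonneg (ρ L : ℝ) (x : R.carrier) : 0 ≤ E.cutoff ρ L x := logCutoff_nonneg _ _ _

theorem cutoff_of_notMem (ρ L : ℝ) {x : R.carrier} (hx : x ∉ E.Φ.target) : E.cutoff ρ L x = 0 := by
  rw [cutoff, E.trans_of_notMem hx, norm_zero, logCutoff_zero]

/-- Closedness of `{0 < r ≤ ρ}` in `R` prevents the support of the cutoff from accumulating at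
points outside the end, so extension by zero stays smooth. -/
theorem eventually_cutoff_eq_zero {ρ L : ℝ} (hρ : 0 < ρ) (hρε : ρ < E.ε) (hL : 0 < L)
    {x : R.carrier} (hx : x ∉ E.Φ.target) : ∀ᶠ y in 𝓝 x, E.cutoff ρ L y = 0 := by
  have hclosed := E.isClosed_truncated ρ hρ hρε
  have hxn : x ∈ (E.Φ '' {z | 0 < ‖z.2‖ ∧ ‖z.2‖ ≤ ρ})ᶜ := by
    rintro ⟨z, hz, rfl⟩
    refine hx (E.Φ.map_source ?_)
    rw [E.source_eq]
    exact ⟨hz.1, hz.2.trans_lt hρε⟩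
  filter_upwards [hclosed.isOpen_compl.mem_nhds hxn] with y hy
  by_cases hyt : y ∈ E.Φ.target
  · refine logCutoff_of_le hρ hL (le_of_not_ge fun hle =>
      hy ⟨E.Φ.symm y, ⟨?_, ?_⟩, E.Φ.right_inv hyt⟩)
    · rw [← E.trans_of_mem hyt]
      exact norm_pos_iff.2 (E.trans_ne_zero hyt)
    · rw [← E.trans_of_mem hyt]
      exact hle
  · exact E.cutoff_of_notMem ρ L hyt

theorem contMDiff_cutoff {ρ L : ℝ} (hρ : 0 < ρ) (hρε : ρ < E.ε) (hL : 0 < L) :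
    ContMDiff 𝓘(ℝ, EuclideanSpace ℝ (Fin n)) 𝓘(ℝ, ℝ) 1 (E.cutoff ρ L) := by
  intro x
  by_cases hx : x ∈ E.Φ.target
  · have h1 : ContMDiffAt 𝓘(ℝ, EuclideanSpace ℝ (Fin n)) 𝓘(ℝ, EuclideanSpace ℝ (Fin (9 - p))) 1
        (fun x => (E.Φ.symm x).2) x :=
      contMDiffAt_snd.comp x
        ((E.smooth_symm.contMDiffAt (E.Φ.open_target.mem_nhds hx)).of_le (by simp))
    have h2 : ContMDiffAt 𝓘(ℝ, EuclideanSpace ℝ (Fin n)) 𝓘(ℝ, ℝ) 1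
        (fun x => logCutoff ρ L ‖(E.Φ.symm x).2‖) x :=
      ContMDiffAt.comp x (g := fun y : EuclideanSpace ℝ (Fin (9 - p)) => logCutoff ρ L ‖y‖)
        (contDiffAt_logCutoff_norm hρ (E.trans_of_mem hx ▸ E.trans_ne_zero hx)).contMDiffAt h1
    refine h2.congr_of_eventuallyEq ?_
    filter_upwards [E.Φ.open_target.mem_nhds hx] with y hy
    rw [cutoff, E.trans_of_mem hy]
  · refine contMDiffAt_const.congr_of_eventuallyEq (f := fun _ => (0 : ℝ)) ?_
    exact E.eventually_cutoff_eq_zero hρ hρε hL hx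

/-- A bound for the norm of the differential of the cutoff function. -/
def gradBound (ρ L r : ℝ) : ℝ :=
  if ρ * Real.exp (-L) ≤ r ∧ r ≤ ρ then transitionBound / (L * r) * √(2 / E.H r) else 0

theorem differential_cutoff_of_notMem {ρ L : ℝ} (hρ : 0 < ρ) (hρε : ρ < E.ε) (hL : 0 < L)
    {x : R.carrier} (hx : x ∉ E.Φ.target) (v : TangentSpace 𝓘(ℝ, EuclideanSpace ℝ (Fin n)) x) :
    R.differential (E.cutoff ρ L) x v = 0 := by
  have h : E.cutoff ρ L =ᶠ[𝓝 x] fun _ => 0 := E.eventually_cutoff_eq_zero hρ hρε hL hx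
  unfold RiemMfd.differential
  rw [h.mfderiv_eq, mfderiv_const]
  rfl

/-- Composed with `Φ`, the cutoff depends on the second factor alone; uniqueness of the derivative
compares the two chain rules. -/
theorem differential_cutoff_param {ρ L : ℝ} (hρ : 0 < ρ) (hρε : ρ < E.ε) (hL : 0 < L)
    {z : E.M.carrier × EuclideanSpace ℝ (Fin (9 - p))} (hz : z ∈ E.Φ.source)
    (v : TangentSpace 𝓘(ℝ, EuclideanSpace ℝ (Fin (p + 1 - d))) z.1)
    (w : EuclideanSpace ℝ (Fin (9 - p))) :
    R.differential (E.cutoff ρ L) (E.Φ z) (mfderiv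
            (𝓘(ℝ, EuclideanSpace ℝ (Fin (p + 1 - d))).prod 𝓘(ℝ, EuclideanSpace ℝ (Fin (9 - p))))
            𝓘(ℝ, EuclideanSpace ℝ (Fin n)) E.Φ z (v, w))
      = fderiv ℝ (fun y : EuclideanSpace ℝ (Fin (9 - p)) => logCutoff ρ L ‖y‖) z.2 w := by
  have hz2 : z.2 ≠ 0 := by
    rw [← E.trans_param hz]
    exact E.trans_ne_zero (E.Φ.map_source hz)
  have hΦ := ((E.smooth_Φ.contMDiffAt (E.Φ.open_source.mem_nhds hz)).mdifferentiableAt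
    (by simp)).hasMFDerivAt
  have h1 := ((E.contMDiff_cutoff hρ hρε hL).mdifferentiable one_ne_zero (E.Φ z)).hasMFDerivAt.comp
    z hΦ
  have h2 := (((contDiffAt_logCutoff_norm (L := L) hρ hz2).differentiableAt
    one_ne_zero).hasFDerivAt.hasMFDerivAt).comp z
    (hasMFDerivAt_snd (I := 𝓘(ℝ, EuclideanSpace ℝ (Fin (p + 1 - d)))) z)
  have h3 : (E.cutoff ρ L ∘ E.Φ) =ᶠ[𝓝 z]
      (fun y : EuclideanSpace ℝ (Fin (9 - p)) => logCutoff ρ L ‖y‖) ∘ Prod.snd := by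
    filter_upwards [E.Φ.open_source.mem_nhds hz] with z' hz'
    simp [cutoff, E.trans_param hz']
  have h4 := hasMFDerivAt_unique (h2.congr_of_eventuallyEq h3) h1
  exact (congrArg (fun T => T (v, w)) h4).symm

/-- Every tangent vector of the end is the image of some `(v, w)`, and only `w` is seen by the
cutoff. The lower metric bound gives `‖w‖ ≤ √(2 / H)` times the length of the vector, which explains
the factor in `gradBound`. -/
theorem differential_cutoff_le {ρ L : ℝ} (hE : E.Controlled ρ) (hL : 0 < L) (x : R.carrier)
    (v : TangentSpace 𝓘(ℝ, EuclideanSpace ℝ (Fin n)) x) :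
    |R.differential (E.cutoff ρ L) x v|
      ≤ E.gradBound ρ L ‖E.trans x‖ * √(R.metric.inner x v v) := by
  have hρ := hE.pos
  by_cases hx : x ∈ E.Φ.target
  swap
  · rw [E.differential_cutoff_of_notMem hρ hE.lt_eps hL hx, E.trans_of_notMem hx, gradBound,
      if_neg]
    · simp
    · simp [hρ, Real.exp_pos]
  obtain ⟨⟨a, y⟩, hz, rfl⟩ : ∃ z ∈ E.Φ.source, E.Φ z = x :=
    ⟨E.Φ.symm x, E.Φ.map_target hx, E.Φ.right_inv hx⟩
  have hd : E.Φ.MDifferentiable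
      (𝓘(ℝ, EuclideanSpace ℝ (Fin (p + 1 - d))).prod 𝓘(ℝ, EuclideanSpace ℝ (Fin (9 - p))))
      𝓘(ℝ, EuclideanSpace ℝ (Fin n)) :=
    ⟨E.smooth_Φ.mdifferentiableOn (by simp), E.smooth_symm.mdifferentiableOn (by simp)⟩
  obtain ⟨⟨v, w⟩, rfl⟩ := hd.mfderiv_surjective hz v
  have hy : y ≠ 0 := by
    have := E.trans_ne_zero hx
    rwa [E.trans_param hz] at this
  have hy' : 0 < ‖y‖ := norm_pos_iff.2 hy
  rw [E.trans_param hz]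
  have h1 := E.differential_cutoff_param (L := L) hρ hE.lt_eps hL hz v w
  have h2 := abs_fderiv_logCutoff_norm_le (L := L) hρ hy w
  rw [← h1] at h2
  refine h2.trans ?_
  by_cases hann : ρ * Real.exp (-L) ≤ ‖y‖ ∧ ‖y‖ ≤ ρ
  swap
  · rw [deriv_logCutoff_eq_zero hρ hL hy' hann, gradBound, if_neg hann]
    simp
  rw [gradBound, if_pos hann, mul_assoc]
  refine mul_le_mul (abs_deriv_logCutoff_le hρ hL hy') ?_ (norm_nonneg _) ?_
  · have hH := hE.H_pos hy' hann.2
    have h3 := hE.le_metric a y hy' hann.2 v w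
    rw [← Real.sqrt_mul (by positivity)]
    refine Real.le_sqrt_of_sq_le ?_
    calc ‖w‖ ^ 2 = 2 / E.H ‖y‖ * (E.H ‖y‖ * ‖w‖ ^ 2 / 2) := by field_simp
      _ ≤ _ := mul_le_mul_of_nonneg_left h3 (by positivity)
  · have := transitionBound_pos
    positivity
end DpEnd

/-! ### Radial integrals -/

/-- In polar coordinates the integrand is `r^(l-2)`, a nonnegative power. -/
theorem lintegral_norm_inv_ball_lt_top {l : ℕ} (hl : 2 ≤ l) (r : ℝ) :
    ∫⁻ y in Metric.ball (0 : EuclideanSpace ℝ (Fin l)) r, ENNReal.ofReal ‖y‖⁻¹ < ⊤ := by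
  have : Nontrivial (EuclideanSpace ℝ (Fin l)) :=
    Module.nontrivial_of_finrank_pos (R := ℝ) (by simp; omega)
  have h : IntegrableOn (fun y : EuclideanSpace ℝ (Fin l) => ‖y‖⁻¹) (Metric.ball 0 r) := by
    rw [integrableOn_fun_norm_addHaar volume (f := fun r : ℝ => r⁻¹)]
    have h1 : IntegrableOn (fun y : ℝ => y ^ (l - 2)) (Ioo 0 r) :=
      ((continuous_pow _).integrableOn_Icc (a := 0) (b := r)).mono_set Ioo_subset_Icc_self
    refine h1.congr_fun (fun y hy => ?_) measurableSet_Ioo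
    have hy0 : y ≠ 0 := hy.1.ne'
    have : l - 1 = (l - 2) + 1 := by omega
    simp only [finrank_euclideanSpace, Fintype.card_fin, smul_eq_mul]
    rw [this, pow_succ]
    field_simp
  exact h.lintegral_lt_top

/-- In polar coordinates the radial integrand is `r^(l-2) / r ≤ ρ^(l-2) / r`, and `∫ dr / r` over
the annulus is exactly `L`. Growth linear in `L` is what the factor `L⁻²` of the energy can beat. -/
theorem exists_lintegral_annulus_le {l : ℕ} (hl : 2 ≤ l) {ρ : ℝ} (hρ : 0 < ρ) :
    ∃ C : ℝ, ∀ L > 0, ∫⁻ y in {y : EuclideanSpace ℝ (Fin l) | ρ * Real.exp (-L) ≤ ‖y‖ ∧ ‖y‖ ≤ ρ},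
      ENNReal.ofReal (‖y‖ ^ 2)⁻¹ ≤ ENNReal.ofReal (C * L) := by
  have : Nontrivial (EuclideanSpace ℝ (Fin l)) :=
    Module.nontrivial_of_finrank_pos (R := ℝ) (by simp; omega)
  -- `l` times the volume of the unit ball is the area of the unit sphere.
  refine ⟨l * (volume.real (Metric.ball (0 : EuclideanSpace ℝ (Fin l)) 1)) * ρ ^ (l - 2),
    fun L hL => ?_⟩
  set a := ρ * Real.exp (-L) with ha
  have ha0 : 0 < a := by positivity
  have haρ : a ≤ ρ := mul_le_of_le_one_right hρ.le (Real.exp_le_one_iff.2 (by linarith))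
  set F : ℝ → ℝ := (Icc a ρ).indicator fun r => (r ^ 2)⁻¹ with hF
  have hprod : (fun y : ℝ => y ^ (l - 1) • F y)
      = (Icc a ρ).indicator fun y => y ^ (l - 1) * (y ^ 2)⁻¹ := by
    ext y
    by_cases hy : y ∈ Icc a ρ <;> simp [hF, hy]
  have hcont : ∀ k : ℕ, IntegrableOn (fun y : ℝ => y ^ k * (y ^ 2)⁻¹) (Icc a ρ) := fun k => by
    refine ContinuousOn.integrableOn_Icc (ContinuousOn.mul (by fun_prop) ?_)
    exact ContinuousOn.inv₀ (by fun_prop) fun y hy => pow_ne_zero _ (ha0.trans_le hy.1).ne'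
  have hinv : IntegrableOn (fun y : ℝ => ρ ^ (l - 2) * y⁻¹) (Icc a ρ) :=
    ContinuousOn.integrableOn_Icc (continuousOn_const.mul
      (continuousOn_id.inv₀ fun y hy => (ha0.trans_le hy.1).ne'))
  have hint : Integrable (fun y : EuclideanSpace ℝ (Fin l) => F ‖y‖) := by
    rw [integrable_fun_norm_addHaar volume (f := F)]
    simp only [finrank_euclideanSpace, Fintype.card_fin]
    rw [hprod]
    exact ((hcont _).integrable_indicator measurableSet_Icc).integrableOn
  have hset : MeasurableSet {y : EuclideanSpace ℝ (Fin l) | a ≤ ‖y‖ ∧ ‖y‖ ≤ ρ} :=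
    measurable_norm measurableSet_Icc
  have h1 : ∫⁻ y in {y : EuclideanSpace ℝ (Fin l) | a ≤ ‖y‖ ∧ ‖y‖ ≤ ρ},
      ENNReal.ofReal (‖y‖ ^ 2)⁻¹ = ENNReal.ofReal (∫ y : EuclideanSpace ℝ (Fin l), F ‖y‖) := by
    rw [ofReal_integral_eq_lintegral_ofReal hint (Eventually.of_forall fun y =>
      indicator_nonneg (fun r _ => by positivity) _), ← lintegral_indicator hset]
    congr with y
    by_cases hy : a ≤ ‖y‖ ∧ ‖y‖ ≤ ρ <;> simp [hF, indicator, hy]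
  have hsub : Icc a ρ ⊆ Ioi 0 := fun y hy => ha0.trans_le hy.1
  rw [h1, integral_fun_norm_addHaar volume F]
  refine ENNReal.ofReal_le_ofReal ?_
  simp only [finrank_euclideanSpace, Fintype.card_fin, nsmul_eq_mul]
  rw [hprod, setIntegral_indicator measurableSet_Icc, inter_eq_self_of_subset_right
    hsub, smul_eq_mul, mul_assoc, mul_assoc]
  refine mul_le_mul_of_nonneg_left (mul_le_mul_of_nonneg_left ?_ measureReal_nonneg) (by positivity)
  calc ∫ y in Icc a ρ, y ^ (l - 1) * (y ^ 2)⁻¹ ≤ ∫ y in Icc a ρ, ρ ^ (l - 2) * y⁻¹ := by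
        refine setIntegral_mono_on (hcont _) hinv measurableSet_Icc fun y hy => ?_
        have hy0 : 0 < y := ha0.trans_le hy.1
        have : l - 1 = (l - 2) + 1 := by omega
        rw [this]
        calc y ^ (l - 2 + 1) * (y ^ 2)⁻¹ = y ^ (l - 2) * y⁻¹ := by
              rw [pow_succ]
              field_simp
          _ ≤ ρ ^ (l - 2) * y⁻¹ := by
              gcongr
              exact hy.2
    _ = ρ ^ (l - 2) * L := by
        rw [integral_const_mul, integral_Icc_eq_integral_Ioc, ← intervalIntegral.integral_of_le haρ,
          integral_inv_of_pos ha0 hρ]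
        congr 1
        rw [ha, Real.exp_neg]
        have : ρ / (ρ * (Real.exp L)⁻¹) = Real.exp L := by field_simp
        rw [this, Real.log_exp]

namespace DpEnd

open RiemMfd

variable {p d n : ℕ} {R : RiemMfd.{u} n} {f : R.carrier → ℝ} (E : DpEnd p d R f)

/-! ### Lipschitz bounds -/

theorem gradBound_nonneg {ρ L : ℝ} (hρ : 0 < ρ) (hL : 0 < L) (r : ℝ) : 0 ≤ E.gradBound ρ L r := by
  unfold gradBound
  split_ifs with h
  · have h1 := transitionBound_pos
    have : 0 < r := lt_of_lt_of_le (by positivity) h.1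
    positivity
  · exact le_rfl

theorem measurable_gradBound (ρ L : ℝ) : Measurable (E.gradBound ρ L) := by
  refine Measurable.ite measurableSet_Icc ?_ measurable_const
  refine (measurable_const.div (measurable_id.const_mul L)).mul ?_
  exact Real.continuous_sqrt.measurable.comp
    (measurable_const.div (measurable_braneH p E.gs E.r₀))

theorem exists_gradBound_le {ρ L : ℝ} (hE : E.Controlled ρ) (hL : 0 < L) :
    ∃ K : NNReal, ∀ r, E.gradBound ρ L r ≤ K := by
  obtain ⟨c, hc, hH⟩ := hE.H_bound
  have hρ := hE.pos
  have hT := transitionBound_pos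
  refine ⟨⟨transitionBound / (L * (ρ * Real.exp (-L))) * √(2 / c), by positivity⟩, fun r => ?_⟩
  unfold gradBound
  split_ifs with h
  · have hr : 0 < r := lt_of_lt_of_le (by positivity) h.1
    have := hH r hr h.2
    change _ ≤ transitionBound / (L * (ρ * Real.exp (-L))) * √(2 / c)
    gcongr
    exact h.1
  · exact NNReal.coe_nonneg _

/-- For `p ≤ 5` the logarithmic cutoffs are uniformly Lipschitz: the tips are at infinite
distance. -/
theorem exists_gradBound_le_div (hp : p ≤ 5) {ρ : ℝ} (hE : E.Controlled ρ) :
    ∃ C : NNReal, ∀ L > 0, ∀ r, E.gradBound ρ L r ≤ C / L := by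
  obtain ⟨c, hc, hH⟩ := hE.mul_sqrt_H_bound hp
  have hρ := hE.pos
  have hT := transitionBound_pos
  refine ⟨⟨transitionBound * √2 / c, by positivity⟩, fun L hL r => ?_⟩
  change _ ≤ transitionBound * √2 / c / L
  unfold gradBound
  split_ifs with h
  · have hr : 0 < r := lt_of_lt_of_le (by positivity) h.1
    have h1 := hH r hr h.2
    have hHr := Real.sqrt_pos.2 (hE.H_pos hr h.2)
    calc transitionBound / (L * r) * √(2 / E.H r)
        = transitionBound * √2 / (r * √(E.H r)) / L := by
          rw [Real.sqrt_div zero_le_two]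
          field_simp
      _ ≤ transitionBound * √2 / c / L := by gcongr
  · positivity

theorem gradientBoundOn_cutoff {ρ L : ℝ} (hE : E.Controlled ρ) (hL : 0 < L) {K : NNReal}
    {U : Set R.carrier} (hK : ∀ x ∈ U, E.gradBound ρ L ‖E.trans x‖ ≤ K) :
    R.GradientBoundOn (E.cutoff ρ L) K U := fun x hx v =>
  (E.differential_cutoff_le hE hL x v).trans
    (mul_le_mul_of_nonneg_right (hK x hx) (Real.sqrt_nonneg _))

/-- The bound jumps at the boundary of the annulus, but it is locally zero outside the closed
annulus and continuous and positive on it. The factor `2` gives the room needed for a neighbourhood.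
-/
theorem eventually_gradBound_le {ρ L : ℝ} (hE : E.Controlled ρ) (hL : 0 < L) {x : R.carrier}
    (hx : x ∈ E.Φ.target) : ∀ᶠ y in 𝓝 x,
      E.gradBound ρ L ‖E.trans y‖ ≤ 2 * E.gradBound ρ L ‖E.trans x‖ := by
  have hρ := hE.pos
  have hT := transitionBound_pos
  have hcont : ContinuousAt (fun y => ‖E.trans y‖) x := (E.continuousAt_trans hx).norm
  have hpos : 0 < ‖E.trans x‖ := norm_pos_iff.2 (E.trans_ne_zero hx)
  by_cases hann : ρ * Real.exp (-L) ≤ ‖E.trans x‖ ∧ ‖E.trans x‖ ≤ ρ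
  · have hHx := hE.H_pos hpos hann.2
    have hg : ContinuousAt (fun r => transitionBound / (L * r) * √(2 / E.H r)) ‖E.trans x‖ := by
      refine ContinuousAt.mul ?_ (Real.continuous_sqrt.continuousAt.comp ?_)
      · exact continuousAt_const.div (continuousAt_const.mul continuousAt_id) (by positivity)
      · exact continuousAt_const.div (continuousAt_braneH p E.gs E.r₀_pos hpos) hHx.ne'
    have hgx : transitionBound / (L * ‖E.trans x‖) * √(2 / E.H ‖E.trans x‖)
        < 2 * E.gradBound ρ L ‖E.trans x‖ := by
      rw [gradBound, if_pos hann]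
      have : 0 < transitionBound / (L * ‖E.trans x‖) * √(2 / E.H ‖E.trans x‖) := by positivity
      linarith
    filter_upwards [(hg.comp (f := fun y => ‖E.trans y‖) hcont).eventually (gt_mem_nhds hgx)]
      with y hy
    conv_lhs => rw [gradBound]
    split_ifs
    · exact hy.le
    · exact mul_nonneg zero_le_two (E.gradBound_nonneg hρ hL _)
  · have h1 : (Icc (ρ * Real.exp (-L)) ρ)ᶜ ∈ 𝓝 ‖E.trans x‖ := isClosed_Icc.isOpen_compl.mem_nhds hann
    filter_upwards [hcont h1] with y hy
    rw [gradBound, if_neg (show ¬(_ ≤ ‖E.trans y‖ ∧ ‖E.trans y‖ ≤ _) from hy)]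
    exact mul_nonneg zero_le_two (E.gradBound_nonneg hρ hL _)

theorem eventually_edist_cutoff_le {ρ L : ℝ} (hE : E.Controlled ρ) (hL : 0 < L) {X : Type*}
    [MetricSpace X] {ι : R.carrier → X} (hι : IsOpenEmbedding ι)
    (hd : ∀ a b, edist (ι a) (ι b) = R.riemDist a b) (x : R.carrier) :
    ∀ᶠ y in 𝓝 x, edist (E.cutoff ρ L y) (E.cutoff ρ L x)
      ≤ ENNReal.ofReal (2 * E.gradBound ρ L ‖E.trans x‖) * edist (ι y) (ι x) := by
  by_cases hx : x ∈ E.Φ.target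
  · refine R.eventually_edist_le hι hd (E.contMDiff_cutoff hE.pos hE.lt_eps hL)
      (E.eventually_gradBound_le hE hL hx) (E.gradientBoundOn_cutoff hE hL fun y hy => ?_)
    exact hy.trans (Real.le_coe_toNNReal _)
  · filter_upwards [E.eventually_cutoff_eq_zero hE.pos hE.lt_eps hL hx] with y hy
    rw [hy, E.cutoff_of_notMem ρ L hx, edist_self]
    exact zero_le

/-! ### Measure and energy -/

theorem lintegral_H_lt_top (hp : p = 6 ∨ p = 7) (ρ : ℝ) :
    ∫⁻ y in {y : EuclideanSpace ℝ (Fin (9 - p)) | 0 < ‖y‖ ∧ ‖y‖ ≤ ρ}, ENNReal.ofReal (E.H ‖y‖)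
      < ⊤ := by
  obtain ⟨C, hC, hH⟩ := exists_braneH_le hp E.gs_pos E.r₀_pos
  have hm : MeasurableSet {y : EuclideanSpace ℝ (Fin (9 - p)) | 0 < ‖y‖ ∧ ‖y‖ ≤ ρ} :=
    measurable_norm measurableSet_Ioc
  have hsub : {y : EuclideanSpace ℝ (Fin (9 - p)) | 0 < ‖y‖ ∧ ‖y‖ ≤ ρ} ⊆ Metric.ball 0 (ρ + 1) :=
    fun y hy => by
      rw [mem_ball_zero_iff]
      linarith [hy.2]
  calc _ ≤ ∫⁻ y in {y : EuclideanSpace ℝ (Fin (9 - p)) | 0 < ‖y‖ ∧ ‖y‖ ≤ ρ},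
        ENNReal.ofReal C * ENNReal.ofReal ‖y‖⁻¹ := by
        refine setLIntegral_mono' hm fun y hy => ?_
        rw [← ENNReal.ofReal_mul hC.le]
        exact ENNReal.ofReal_le_ofReal (hH _ hy.1)
    _ ≤ ∫⁻ y in Metric.ball (0 : EuclideanSpace ℝ (Fin (9 - p))) (ρ + 1),
        ENNReal.ofReal C * ENNReal.ofReal ‖y‖⁻¹ := lintegral_mono_set hsub
    _ < ⊤ := by
        rw [lintegral_const_mul' _ _ ENNReal.ofReal_ne_top]
        exact ENNReal.mul_lt_top ENNReal.ofReal_lt_top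
          (lintegral_norm_inv_ball_lt_top (by omega) _)

/-- The measure in the end is at most a constant times `H(|y|) dy`: the product of the weight
`H ^ ((p - 7) / 2)` with the transverse volume density `H ^ ((9 - p) / 2)`. -/
theorem exists_measure_preimage_trans_le (hp : p = 6 ∨ p = 7) (hd : d ≤ p + 1)
    (hn : n = 10 - d) {μ : Measure R.carrier}
    (hμ : R.IsWeightedVolume (fun x => Real.exp (f x)) μ) (hM : E.M.HasFiniteVolume)
    {ρ : ℝ} (hE : E.Controlled ρ) :
    ∃ C : ℝ≥0∞, C ≠ ⊤ ∧ ∀ B : Set (EuclideanSpace ℝ (Fin (9 - p))), MeasurableSet B →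
      (∀ y ∈ B, 0 < ‖y‖ ∧ ‖y‖ ≤ ρ) →
      μ (E.trans ⁻¹' B) ≤ C * ∫⁻ y in B, ENNReal.ofReal (E.H ‖y‖) := by
  obtain ⟨ν, hν, hνfin⟩ := hM
  -- The dimension count uses truncated subtraction: it needs `d ≤ p + 1` and `p ≤ 9`.
  have h : (p + 1 - d) + (9 - p) = n := by omega
  have hHm : Measurable fun y : EuclideanSpace ℝ (Fin (9 - p)) => E.H ‖y‖ :=
    (measurable_braneH p E.gs E.r₀).comp measurable_norm
  -- The factor `2` comes from the weight and `√(2 ^ n)` from the metric bound with `κ = 2`.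
  refine ⟨ν univ * ENNReal.ofReal (2 * √(2 ^ n)),
    ENNReal.mul_ne_top hνfin.ne ENNReal.ofReal_ne_top, fun B hB hBρ => ?_⟩
  have hBε : ∀ y ∈ B, 0 < ‖y‖ ∧ ‖y‖ < E.ε := fun y hy =>
    ⟨(hBρ y hy).1, (hBρ y hy).2.trans_lt hE.lt_eps⟩
  have hfac : ∫⁻ y in B, ENNReal.ofReal (2 * √(2 ^ n) * E.H ‖y‖)
      = ENNReal.ofReal (2 * √(2 ^ n)) * ∫⁻ y in B, ENNReal.ofReal (E.H ‖y‖) := by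
    rw [← lintegral_const_mul' _ _ ENNReal.ofReal_ne_top]
    simp_rw [ENNReal.ofReal_mul (show (0 : ℝ) ≤ 2 * √(2 ^ n) by positivity)]
  have hfin : ∫⁻ y in B, ENNReal.ofReal (E.H ‖y‖) ≠ ⊤ :=
    ((lintegral_mono_set fun y hy => hBρ y hy).trans_lt (E.lintegral_H_lt_top hp ρ)).ne
  rw [E.preimage_trans hBε, mul_assoc, ← hfac]
  refine hμ.image_prod_le h E.isSmoothParam hν hB ?_ (κ := 2) (H := fun y => E.H ‖y‖)
    (W := fun y => 2 * E.H ‖y‖ ^ (((p : ℝ) - 7) / 2)) ?_ ?_ ?_ ?_ ?_ ?_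
  · rw [E.source_eq]
    exact fun z hz => hBε _ hz.2
  · exact fun a y hy => hE.metric_le a y (hBρ y hy).1 (hBρ y hy).2
  · exact fun a y hy => hE.weight_le a y (hBρ y hy).1 (hBρ y hy).2
  · intro y hy
    have := hE.H_pos (hBρ y hy).1 (hBρ y hy).2
    positivity
  · intro y hy
    have hH := hE.H_pos (hBρ y hy).1 (hBρ y hy).2
    have h9 : ((9 - p : ℕ) : ℝ) = 9 - p := by
      rw [Nat.cast_sub (by omega)]
      norm_num
    have hsq : √(E.H ‖y‖ ^ (9 - p)) = E.H ‖y‖ ^ ((9 - (p : ℝ)) / 2) := by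
      rw [Real.sqrt_eq_rpow, ← Real.rpow_natCast, ← Real.rpow_mul hH.le, h9]
      congr 1
      ring
    rw [Real.sqrt_mul (by positivity), hsq]
    refine le_of_eq ?_
    calc 2 * E.H ‖y‖ ^ (((p : ℝ) - 7) / 2) * (√(2 ^ n) * E.H ‖y‖ ^ ((9 - (p : ℝ)) / 2))
        = 2 * √(2 ^ n) * (E.H ‖y‖ ^ (((p : ℝ) - 7) / 2) * E.H ‖y‖ ^ ((9 - (p : ℝ)) / 2)) := by ring
      _ = 2 * √(2 ^ n) * E.H ‖y‖ := by
        rw [← Real.rpow_add hH]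
        have : ((p : ℝ) - 7) / 2 + (9 - (p : ℝ)) / 2 = 1 := by ring
        rw [this, Real.rpow_one]
  · exact hHm.const_mul _
  · rw [hfac]
    exact ENNReal.mul_ne_top ENNReal.ofReal_ne_top hfin

theorem measure_region_lt_top (hp : p = 6 ∨ p = 7) (hd : d ≤ p + 1)
    (hn : n = 10 - d) {μ : Measure R.carrier}
    (hμ : R.IsWeightedVolume (fun x => Real.exp (f x)) μ) (hM : E.M.HasFiniteVolume)
    {ρ : ℝ} (hE : E.Controlled ρ) : μ (E.trans ⁻¹' {y | 0 < ‖y‖ ∧ ‖y‖ ≤ ρ}) < ⊤ := by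
  obtain ⟨C, hC, hle⟩ := E.exists_measure_preimage_trans_le hp hd hn hμ hM hE
  refine (hle _ (measurable_norm measurableSet_Ioc) fun y hy => hy).trans_lt ?_
  exact ENNReal.mul_lt_top hC.lt_top (E.lintegral_H_lt_top hp ρ)

/-- Dominated convergence: the cutoffs tend to `0` pointwise and are bounded by the indicator of `{0
< r ≤ ρ}`, which has finite measure. -/
theorem tendsto_lintegral_cutoff_sq (hp : p = 6 ∨ p = 7) (hd : d ≤ p + 1)
    (hn : n = 10 - d) {μ : Measure R.carrier}
    (hμ : R.IsWeightedVolume (fun x => Real.exp (f x)) μ) (hM : E.M.HasFiniteVolume)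
    {ρ : ℝ} (hE : E.Controlled ρ) :
    Tendsto (fun k : ℕ => ∫⁻ x, ENNReal.ofReal (E.cutoff ρ (k + 1) x) ^ 2 ∂μ) atTop (𝓝 0) := by
  set S := E.trans ⁻¹' {y | 0 < ‖y‖ ∧ ‖y‖ ≤ ρ} with hS
  have hSm : MeasurableSet S := E.measurable_trans (measurable_norm measurableSet_Ioc)
  have hlim : ∫⁻ _ : R.carrier, (0 : ℝ≥0∞) ∂μ = 0 := lintegral_zero
  rw [← hlim]
  refine tendsto_lintegral_of_dominated_convergence (S.indicator 1) (fun k => ?_) (fun k => ?_) ?_ ?_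
  · exact (((measurable_logCutoff ρ _).comp (measurable_norm.comp
      E.measurable_trans)).ennreal_ofReal).pow_const 2
  · refine Eventually.of_forall fun x => ?_
    by_cases hx : x ∈ S
    · rw [indicator_of_mem hx]
      have : ENNReal.ofReal (E.cutoff ρ (k + 1) x) ≤ 1 :=
        ENNReal.ofReal_le_one.2 (logCutoff_le_one _ _ _)
      exact pow_le_one₀ (zero_le) this
    · rw [indicator_of_notMem hx]
      have h0 : E.cutoff ρ (k + 1) x = 0 := by
        unfold cutoff
        rcases (norm_nonneg (E.trans x)).eq_or_lt with h | h
        · rw [← h, logCutoff_zero]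
        · refine logCutoff_of_le hE.pos (by positivity) (le_of_not_ge fun hle => hx ⟨h, hle⟩)
      simp [h0]
  · rw [lintegral_indicator_one hSm]
    exact (E.measure_region_lt_top hp hd hn hμ hM hE).ne
  · refine Eventually.of_forall fun x => ?_
    have h1 : Tendsto (fun k : ℕ => E.cutoff ρ (k + 1) x) atTop (𝓝 0) :=
      (tendsto_logCutoff ρ ‖E.trans x‖).comp
        (tendsto_atTop_add_const_right _ _ tendsto_natCast_atTop_atTop)
    simpa [Function.comp_def] using
      (ENNReal.continuous_pow 2).continuousAt.tendsto.comp (ENNReal.tendsto_ofReal h1)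

/-- After pushing forward to the transverse variable, the density `H` cancels the `1 / H` in the
squared gradient. What remains is `L⁻²` times the annulus integral of `|y|⁻²`, hence `O(1 / L)`. -/
theorem tendsto_lintegral_gradBound_sq (hp : p = 6 ∨ p = 7) (hd : d ≤ p + 1)
    (hn : n = 10 - d) {μ : Measure R.carrier}
    (hμ : R.IsWeightedVolume (fun x => Real.exp (f x)) μ) (hM : E.M.HasFiniteVolume)
    {ρ : ℝ} (hE : E.Controlled ρ) :
    Tendsto (fun k : ℕ => ∫⁻ x, ENNReal.ofReal (2 * E.gradBound ρ (k + 1) ‖E.trans x‖) ^ 2 ∂μ)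
      atTop (𝓝 0) := by
  obtain ⟨C, hC, hle⟩ := E.exists_measure_preimage_trans_le hp hd hn hμ hM hE
  obtain ⟨D, hD⟩ := exists_lintegral_annulus_le (l := 9 - p) (by omega) hE.pos
  have hρ := hE.pos
  have hHm : Measurable fun y : EuclideanSpace ℝ (Fin (9 - p)) => E.H ‖y‖ :=
    (measurable_braneH p E.gs E.r₀).comp measurable_norm
  have hbound : ∀ L > 0, ∫⁻ x, ENNReal.ofReal (2 * E.gradBound ρ L ‖E.trans x‖) ^ 2 ∂μ
      ≤ C * ENNReal.ofReal (8 * transitionBound ^ 2 * D / L) := by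
    intro L hL
    set A := {y : EuclideanSpace ℝ (Fin (9 - p)) | ρ * Real.exp (-L) ≤ ‖y‖ ∧ ‖y‖ ≤ ρ} with hA
    have hAm : MeasurableSet A := measurable_norm measurableSet_Icc
    have hApos : ∀ y ∈ A, 0 < ‖y‖ := fun y hy => lt_of_lt_of_le (by positivity) hy.1
    set g : EuclideanSpace ℝ (Fin (9 - p)) → ℝ≥0∞ :=
      fun y => ENNReal.ofReal (2 * E.gradBound ρ L ‖y‖) ^ 2 with hg
    have hgA : A.indicator g = g := by
      refine indicator_eq_self.2 fun y hy => ?_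
      by_contra hyA
      refine hy ?_
      simp only [hg]
      rw [gradBound, if_neg (show ¬(_ ≤ ‖y‖ ∧ ‖y‖ ≤ ρ) from hyA)]
      simp
    have hgm : Measurable g :=
      (((E.measurable_gradBound ρ L).comp measurable_norm).const_mul 2).ennreal_ofReal.pow_const 2
    -- The bound holds for every Borel subset of the annulus, so it is an inequality of measures and
    -- can be integrated against `g`.
    have hmeas : (μ.map E.trans).restrict A
        ≤ C • (volume.restrict A).withDensity fun y => ENNReal.ofReal (E.H ‖y‖) := by
      refine Measure.le_iff.2 fun s hs => ?_
      rw [Measure.restrict_apply hs, Measure.map_apply E.measurable_trans (hs.inter hAm),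
        Measure.smul_apply, smul_eq_mul, withDensity_apply _ hs, Measure.restrict_restrict hs]
      exact hle _ (hs.inter hAm) fun y hy => ⟨hApos y hy.2, hy.2.2⟩
    calc ∫⁻ x, ENNReal.ofReal (2 * E.gradBound ρ L ‖E.trans x‖) ^ 2 ∂μ
        = ∫⁻ y, g y ∂(μ.map E.trans) := (lintegral_map hgm E.measurable_trans).symm
      _ = ∫⁻ y in A, g y ∂(μ.map E.trans) := by
          rw [← lintegral_indicator hAm]
          rw [hgA]
      _ ≤ ∫⁻ y, g y ∂(C • (volume.restrict A).withDensity fun y => ENNReal.ofReal (E.H ‖y‖)) :=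
          lintegral_mono' hmeas le_rfl
      _ = C * ∫⁻ y in A, ENNReal.ofReal (E.H ‖y‖) * g y := by
          rw [lintegral_smul_measure, smul_eq_mul,
            lintegral_withDensity_eq_lintegral_mul _ hHm.ennreal_ofReal hgm]
          rfl
      -- Here `H` cancels; `8` is `2²` from the doubled gradient bound times the `2` of `2 / H`.
      _ = C * ∫⁻ y in A, ENNReal.ofReal (8 * transitionBound ^ 2 / L ^ 2)
            * ENNReal.ofReal (‖y‖ ^ 2)⁻¹ := by
          congr 1
          refine setLIntegral_congr_fun hAm fun y hy => ?_
          have hy0 := hApos y hy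
          have hH := hE.H_pos hy0 hy.2
          have hT := transitionBound_pos
          simp only [hg]
          rw [gradBound, if_pos (show _ ≤ ‖y‖ ∧ ‖y‖ ≤ ρ from hy),
            ← ENNReal.ofReal_pow (by positivity), ← ENNReal.ofReal_mul hH.le,
            ← ENNReal.ofReal_mul (by positivity)]
          congr 1
          rw [mul_pow, mul_pow, Real.sq_sqrt (by positivity)]
          field_simp
          ring
      _ ≤ C * (ENNReal.ofReal (8 * transitionBound ^ 2 / L ^ 2) * ENNReal.ofReal (D * L)) := by
          rw [lintegral_const_mul' _ _ ENNReal.ofReal_ne_top]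
          gcongr
          exact hD L hL
      _ = C * ENNReal.ofReal (8 * transitionBound ^ 2 * D / L) := by
          rw [← ENNReal.ofReal_mul (by positivity)]
          congr 2
          field_simp
  refine tendsto_of_tendsto_of_tendsto_of_le_of_le tendsto_const_nhds ?_ (fun _ => zero_le)
    fun k : ℕ => hbound (k + 1) (by positivity)
  have h1 : Tendsto (fun k : ℕ => 8 * transitionBound ^ 2 * D / ((k : ℝ) + 1)) atTop (𝓝 0) :=
    tendsto_const_nhds.div_atTop
      (tendsto_atTop_add_const_right _ _ tendsto_natCast_atTop_atTop)
  simpa using ENNReal.Tendsto.const_mul (ENNReal.tendsto_ofReal h1) (Or.inr hC)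

end DpEnd

theorem lipschitzWith_of_denseRange {α X : Type*} [MetricSpace X] {ι : α → X} (hι : DenseRange ι)
    {u : X → ℝ} (hu : Continuous u) {K : NNReal}
    (h : ∀ a b, edist (u (ι a)) (u (ι b)) ≤ K * edist (ι a) (ι b)) : LipschitzWith K u := by
  intro x y
  refine hι.induction_on₂ (p := fun x y => edist (u x) (u y) ≤ K * edist x y) ?_ h x y
  refine isClosed_le ?_ ?_
  · exact (hu.comp continuous_fst).edist (hu.comp continuous_snd)
  · exact (ENNReal.continuous_const_mul ENNReal.coe_ne_top).comp continuous_edist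

theorem edist_sum_sum_le {ι : Type*} (s : Finset ι) (f g : ι → ℝ) :
    edist (∑ i ∈ s, f i) (∑ i ∈ s, g i) ≤ ∑ i ∈ s, edist (f i) (g i) := by
  simp_rw [edist_eq_enorm_sub]
  rw [← Finset.sum_sub_distrib]
  exact enorm_sum_le _ _

theorem isClosed_singularSet {X : Type u} [MetricSpace X] [MeasurableSpace X] (m : Measure X) :
    IsClosed (singularSet m) :=
  isClosed_sInter fun _ hS => hS.1

/-! ### Tips, gluing of the cutoffs and conclusion -/

namespace AsymptoticallyDpBrane

variable {X : Type u} [MetricSpace X] [MeasurableSpace X] {m : Measure X} {p d : ℕ}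
  (B : AsymptoticallyDpBrane X m p d)

/-- The set of tips. -/
def tips : Set X := (range B.incl)ᶜ

theorem isClosed_tips : IsClosed B.tips := B.isOpenEmbedding_incl.isOpen_range.isClosed_compl

theorem hasSmoothComplement_tips [BorelSpace X] : HasSmoothComplement m B.tips := by
  set h₀ : B.R.carrier ≃ₜ range B.incl := B.isOpenEmbedding_incl.isEmbedding.toHomeomorph
  set h : B.R.carrier ≃ₜ ↥(B.tipsᶜ) := h₀.trans (Homeomorph.setCongr (compl_compl _).symm) with hh
  have hval : ∀ a, (h a : X) = B.incl a := fun a => rfl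
  have hval' : ∀ x : ↥(B.tipsᶜ), B.incl (h.symm x) = x := fun x => by
    rw [← hval, h.apply_symm_apply]
  refine ⟨10 - d, B.R, B.f, B.vol, h.symm, B.smooth_f, B.isWeightedVolume_vol,
    h.symm.isOpenEmbedding, fun x y => ?_, ?_⟩
  · rw [← B.edist_incl, hval', hval']
    rfl
  · rw [h.symm.range_coe, Measure.restrict_univ]
    ext s hs
    rw [Measure.map_apply h.symm.measurable hs]
    have hemb : MeasurableEmbedding (Subtype.val : ↥(B.tipsᶜ) → X) :=
      MeasurableEmbedding.subtype_coe B.isClosed_tips.isOpen_compl.measurableSet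
    rw [hemb.comap_apply]
    have himg : Subtype.val '' (h.symm ⁻¹' s) = B.incl '' s := by
      ext x
      constructor
      · rintro ⟨x, hx, rfl⟩
        exact ⟨_, hx, hval' x⟩
      · rintro ⟨a, ha, rfl⟩
        exact ⟨h a, by simpa using ha, hval a⟩
    have hincl := B.isOpenEmbedding_incl.measurableEmbedding
    rw [himg]
    refine (congrArg (fun μ : Measure X => μ (B.incl '' s)) B.measure_eq).trans ?_
    rw [hincl.map_apply, B.isOpenEmbedding_incl.injective.preimage_image]

theorem singularSet_subset_tips [BorelSpace X] : singularSet m ⊆ B.tips :=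
  sInter_subset_of_mem ⟨B.isClosed_tips, B.hasSmoothComplement_tips⟩

theorem isPolar_singularSet_of_tips_eq_empty [BorelSpace X] (h : B.tips = ∅) :
    IsPolar m (singularSet m) := by
  have h' : singularSet m = ∅ := subset_empty_iff.1 (h ▸ B.singularSet_subset_tips)
  rw [h']
  exact isPolar_empty m

/-- Without ends the set of tips would itself be open, against the density of `R`. An end is needed
to know that the common `ρ` is positive. -/
theorem nonempty_ends (h : B.tips.Nonempty) : Nonempty (Fin B.numEnds) := by
  by_contra hends
  rw [not_nonempty_iff] at hends
  obtain ⟨t, ht⟩ := h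
  have hopen := B.isOpen_tips_union 1 one_pos
  rw [iUnion_of_empty, union_empty] at hopen
  have : Nonempty X := ⟨t⟩
  obtain ⟨_, hx, hx'⟩ := B.denseRange_incl.inter_open_nonempty _ hopen ⟨t, ht⟩
  exact hx hx'

theorem exists_controlled : ∃ ρ, ∀ i, (B.ends i).Controlled ρ :=
  (eventually_all.2 fun i => (B.ends i).eventually_controlled).exists

/-! ### The cutoff functions on the smooth part -/

/-- The sum of the cutoff functions of the ends. -/
def cutoffSum (ρ L : ℝ) (x : B.R.carrier) : ℝ := ∑ i, (B.ends i).cutoff ρ L x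

theorem cutoffSum_eq {ρ L : ℝ} {x : B.R.carrier} {i : Fin B.numEnds}
    (hx : x ∈ (B.ends i).Φ.target) : B.cutoffSum ρ L x = (B.ends i).cutoff ρ L x :=
  Finset.sum_eq_single i (fun j _ hj => (B.ends j).cutoff_of_notMem ρ L
    (disjoint_left.1 (B.disjoint_ends hj.symm) hx)) (by simp)

theorem cutoffSum_nonneg (ρ L : ℝ) (x : B.R.carrier) : 0 ≤ B.cutoffSum ρ L x :=
  Finset.sum_nonneg fun _ _ => logCutoff_nonneg _ _ _

theorem cutoffSum_le_one (ρ L : ℝ) (x : B.R.carrier) : B.cutoffSum ρ L x ≤ 1 := by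
  by_cases h : ∃ i, x ∈ (B.ends i).Φ.target
  · obtain ⟨i, hi⟩ := h
    rw [B.cutoffSum_eq hi]
    exact logCutoff_le_one _ _ _
  · push Not at h
    rw [cutoffSum, Finset.sum_eq_zero fun i _ => (B.ends i).cutoff_of_notMem ρ L (h i)]
    exact zero_le_one

/-- The ends are disjoint, so at most one term is nonzero and there are no cross terms. -/
theorem sq_sum_eq {x : B.R.carrier} {g : Fin B.numEnds → ℝ≥0∞}
    (hg : ∀ i, x ∉ (B.ends i).Φ.target → g i = 0) : (∑ i, g i) ^ 2 = ∑ i, g i ^ 2 := by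
  by_cases h : ∃ i, x ∈ (B.ends i).Φ.target
  · obtain ⟨i, hi⟩ := h
    have hj : ∀ j, j ≠ i → g j = 0 := fun j hj =>
      hg j (disjoint_left.1 (B.disjoint_ends hj.symm) hi)
    rw [Finset.sum_eq_single i (fun j _ h => hj j h) (by simp),
      Finset.sum_eq_single i (fun j _ h => by rw [hj j h]; simp) (by simp)]
  · push Not at h
    simp [hg _ (h _)]

theorem edist_cutoffSum_le {ρ L : ℝ} (hρ : ∀ i, (B.ends i).Controlled ρ) (hL : 0 < L) {K : NNReal}
    (hK : ∀ i r, (B.ends i).gradBound ρ L r ≤ K) (a b : B.R.carrier) :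
    edist (B.cutoffSum ρ L a) (B.cutoffSum ρ L b)
      ≤ (B.numEnds * K : NNReal) * edist (B.incl a) (B.incl b) := by
  have h : ∀ i, edist ((B.ends i).cutoff ρ L a) ((B.ends i).cutoff ρ L b)
      ≤ K * edist (B.incl a) (B.incl b) := fun i => by
    rw [B.edist_incl]
    -- The gradient bound is global, so `s = ⊤` is allowed; the Riemannian distance is finite
    -- because it is the distance of `X`.
    refine B.R.edist_le_mul_riemDist (s := ⊤) ((B.ends i).contMDiff_cutoff (hρ i).pos
      (hρ i).lt_eps hL) ((B.ends i).gradientBoundOn_cutoff (U := univ) (hρ i) hL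
        fun x _ => hK i _) (fun _ _ => mem_univ _) ?_
    rw [← B.edist_incl]
    exact edist_lt_top _ _
  calc edist (B.cutoffSum ρ L a) (B.cutoffSum ρ L b)
      ≤ ∑ i, edist ((B.ends i).cutoff ρ L a) ((B.ends i).cutoff ρ L b) := edist_sum_sum_le _ _ _
    _ ≤ ∑ _i : Fin B.numEnds, K * edist (B.incl a) (B.incl b) := Finset.sum_le_sum fun i _ => h i
    _ = _ := by simp [mul_assoc]

/-! ### The cutoff functions on `X` -/

/-- The cutoff function, equal to `1` at the tips. -/
def tipCutoff (ρ L : ℝ) : X → ℝ := Function.extend B.incl (B.cutoffSum ρ L) fun _ => 1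

theorem tipCutoff_incl (ρ L : ℝ) (x : B.R.carrier) :
    B.tipCutoff ρ L (B.incl x) = B.cutoffSum ρ L x :=
  B.isOpenEmbedding_incl.injective.extend_apply _ _ _

theorem tipCutoff_of_mem_tips (ρ L : ℝ) {x : X} (hx : x ∈ B.tips) : B.tipCutoff ρ L x = 1 :=
  Function.extend_apply' _ _ _ hx

theorem tipCutoff_mem_Icc (ρ L : ℝ) (x : X) : 0 ≤ B.tipCutoff ρ L x ∧ B.tipCutoff ρ L x ≤ 1 := by
  by_cases hx : x ∈ range B.incl
  · obtain ⟨a, rfl⟩ := hx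
    rw [B.tipCutoff_incl]
    exact ⟨B.cutoffSum_nonneg ρ L a, B.cutoffSum_le_one ρ L a⟩
  · rw [B.tipCutoff_of_mem_tips ρ L hx]
    exact ⟨zero_le_one, le_rfl⟩

theorem eventually_tipCutoff_eq_one {ρ L : ℝ} (hρ : 0 < ρ) (hL : 0 < L) :
    ∀ᶠ x in 𝓝ˢ B.tips, B.tipCutoff ρ L x = 1 := by
  -- `ρ e^{-L}` is the radius below which every logarithmic cutoff equals `1`.
  have hopen := B.isOpen_tips_union (ρ * Real.exp (-L)) (by positivity)
  refine mem_of_superset (hopen.mem_nhdsSet.2 subset_union_left) ?_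
  rintro x (hx | hx)
  · exact B.tipCutoff_of_mem_tips ρ L hx
  · simp only [mem_iUnion] at hx
    obtain ⟨i, _, ⟨z, ⟨hz, hzρ⟩, rfl⟩, rfl⟩ := hx
    change B.tipCutoff ρ L _ = 1
    have hz0 : 0 < ‖z.2‖ := by
      rw [(B.ends i).source_eq] at hz
      exact hz.1
    rw [B.tipCutoff_incl, B.cutoffSum_eq ((B.ends i).Φ.map_source hz), DpEnd.cutoff,
      (B.ends i).trans_param hz]
    exact logCutoff_of_le_exp hL hz0 hzρ.le

theorem continuous_tipCutoff {ρ L : ℝ} (hρ : ∀ i, (B.ends i).Controlled ρ) (hρ0 : 0 < ρ)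
    (hL : 0 < L) : Continuous (B.tipCutoff ρ L) := by
  refine continuous_iff_continuousAt.2 fun x => ?_
  by_cases hx : x ∈ range B.incl
  · obtain ⟨a, rfl⟩ := hx
    rw [← B.isOpenEmbedding_incl.continuousAt_iff]
    have : B.tipCutoff ρ L ∘ B.incl = B.cutoffSum ρ L := funext (B.tipCutoff_incl ρ L)
    rw [this]
    refine (continuous_finsetSum _ fun i _ => ?_).continuousAt
    exact ((B.ends i).contMDiff_cutoff hρ0 (hρ i).lt_eps hL).continuous
  · have h := (B.eventually_tipCutoff_eq_one (ρ := ρ) hρ0 hL).filter_mono (nhds_le_nhdsSet hx)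
    exact (continuousAt_const (y := (1 : ℝ))).congr (h.mono fun _ h => h.symm)

theorem lipschitzWith_tipCutoff {ρ L : ℝ} (hρ : ∀ i, (B.ends i).Controlled ρ) (hρ0 : 0 < ρ)
    (hL : 0 < L) {K : NNReal} (hK : ∀ i r, (B.ends i).gradBound ρ L r ≤ K) :
    LipschitzWith (B.numEnds * K) (B.tipCutoff ρ L) :=
  lipschitzWith_of_denseRange B.denseRange_incl (B.continuous_tipCutoff hρ hρ0 hL) fun a b => by
    rw [B.tipCutoff_incl, B.tipCutoff_incl]
    exact B.edist_cutoffSum_le hρ hL hK a b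

theorem exists_lipschitzWith_tipCutoff {ρ L : ℝ} (hρ : ∀ i, (B.ends i).Controlled ρ) (hρ0 : 0 < ρ)
    (hL : 0 < L) : ∃ K, LipschitzWith K (B.tipCutoff ρ L) := by
  choose K hK using fun i => (B.ends i).exists_gradBound_le (hρ i) hL
  refine ⟨_, B.lipschitzWith_tipCutoff hρ hρ0 hL (K := ∑ i, K i) fun i r => (hK i r).trans ?_⟩
  exact_mod_cast Finset.single_le_sum (f := K) (fun _ _ => zero_le) (Finset.mem_univ i)

theorem metricSlope_tipCutoff_le {ρ L : ℝ} (hρ : ∀ i, (B.ends i).Controlled ρ) (hL : 0 < L)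
    (x : B.R.carrier) : metricSlope (B.tipCutoff ρ L) (B.incl x)
      ≤ ∑ i, ENNReal.ofReal (2 * (B.ends i).gradBound ρ L ‖(B.ends i).trans x‖) := by
  refine metricSlope_le ?_
  rw [← B.isOpenEmbedding_incl.map_nhds_eq, eventually_map]
  filter_upwards [eventually_all.2 fun i => (B.ends i).eventually_edist_cutoff_le (hρ i) hL
    B.isOpenEmbedding_incl B.edist_incl x] with y hy
  rw [B.tipCutoff_incl, B.tipCutoff_incl, Finset.sum_mul]
  exact (edist_sum_sum_le _ _ _).trans (Finset.sum_le_sum fun i _ => hy i)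

/-- The tips are null, so neither the value of the cutoff nor its slope there matters. -/
theorem lintegral_eq [BorelSpace X] (g : X → ℝ≥0∞) :
    ∫⁻ x, g x ∂m = ∫⁻ x, g (B.incl x) ∂B.vol := by
  refine (congrArg (fun μ : Measure X => ∫⁻ x, g x ∂μ) B.measure_eq).trans ?_
  exact B.isOpenEmbedding_incl.measurableEmbedding.lintegral_map _

/-- For `p ≤ 5` the ends are complete, so that there are no tips. -/
theorem tips_eq_empty (hp : p ≤ 5) : B.tips = ∅ := by
  by_contra hne
  obtain ⟨t, ht⟩ := nonempty_iff_ne_empty.2 hne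
  obtain ⟨ρ, hρ⟩ := B.exists_controlled
  have : Nonempty X := ⟨t⟩
  obtain ⟨a⟩ := B.denseRange_incl.nonempty_iff.2 this
  obtain ⟨i₀⟩ := B.nonempty_ends ⟨t, ht⟩
  have hρ0 : 0 < ρ := (hρ i₀).pos
  choose C hC using fun i => (B.ends i).exists_gradBound_le_div hp (hρ i)
  -- A tip `t` is compared with a fixed point `a` of `R`. As `L → ∞` the left side tends to `1`
  -- while the Lipschitz constant tends to `0`.
  have hlip : ∀ L : ℝ, 0 < L → 1 - B.cutoffSum ρ L a
      ≤ B.numEnds * ((∑ i, C i : NNReal) / L) * dist t (B.incl a) := by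
    intro L hL
    have h := (B.lipschitzWith_tipCutoff hρ hρ0 hL (K := (∑ i, C i) / L.toNNReal) fun i r =>
      (hC i L hL r).trans ?_).dist_le_mul t (B.incl a)
    · rw [B.tipCutoff_of_mem_tips ρ L ht, B.tipCutoff_incl, Real.dist_eq] at h
      refine (le_abs_self _).trans (h.trans_eq ?_)
      simp [hL.le]
    · rw [NNReal.coe_div, Real.coe_toNNReal L hL.le]
      gcongr
      exact_mod_cast Finset.single_le_sum (f := C) (fun _ _ => zero_le) (Finset.mem_univ i)
  have h1 : Tendsto (fun L => 1 - B.cutoffSum ρ L a) atTop (𝓝 (1 - ∑ _i : Fin B.numEnds, (0 : ℝ))) :=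
    tendsto_const_nhds.sub (tendsto_finsetSum _ fun i _ => tendsto_logCutoff ρ _)
  have h2 : Tendsto (fun L : ℝ => B.numEnds * ((∑ i, C i : NNReal) / L) * dist t (B.incl a)) atTop
      (𝓝 (B.numEnds * 0 * dist t (B.incl a))) :=
    ((tendsto_const_nhds.div_atTop tendsto_id).const_mul _).mul_const _
  have h3 := le_of_tendsto_of_tendsto h1 h2 ((eventually_gt_atTop 0).mono hlip)
  norm_num at h3

theorem isPolar_singularSet_of_finite_volume [BorelSpace X] (hp : p = 6 ∨ p = 7) (hd : d ≤ p + 1)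
    (hM : ∀ i, (B.ends i).M.HasFiniteVolume) : IsPolar m (singularSet m) := by
  rcases B.tips.eq_empty_or_nonempty with hemp | hne
  · exact B.isPolar_singularSet_of_tips_eq_empty hemp
  obtain ⟨ρ, hρ⟩ := B.exists_controlled
  obtain ⟨i₀⟩ := B.nonempty_ends hne
  have hρ0 : 0 < ρ := (hρ i₀).pos
  -- The cutoff scales are `L = k + 1`, positive for every `k`. Being `1` near all tips, the cutoffs
  -- are `1` near the smaller singular set.
  refine isPolar_of_cutoffs (isClosed_singularSet m).measurableSet
    (fun k => B.tipCutoff ρ (k + 1))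
    (fun k => B.exists_lipschitzWith_tipCutoff hρ hρ0 (by positivity))
    (fun k => (B.eventually_tipCutoff_eq_one hρ0 (by positivity)).filter_mono
      (nhdsSet_mono B.singularSet_subset_tips)) (fun k => B.tipCutoff_mem_Icc ρ _) ?_ ?_
  · have hlim := tendsto_finsetSum Finset.univ fun i _ =>
      (B.ends i).tendsto_lintegral_cutoff_sq hp hd rfl B.isWeightedVolume_vol (hM i) (hρ i)
    rw [Finset.sum_const_zero] at hlim
    refine hlim.congr fun k => ?_
    rw [B.lintegral_eq, ← lintegral_finsetSum _ fun i _ => ?_]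
    · refine lintegral_congr fun x => ?_
      rw [B.tipCutoff_incl, Real.enorm_of_nonneg (B.cutoffSum_nonneg _ _ _), cutoffSum,
        ENNReal.ofReal_sum_of_nonneg fun i _ => (B.ends i).cutoff_nonneg _ _ x]
      refine (B.sq_sum_eq (x := x) fun i hi => ?_).symm
      rw [(B.ends i).cutoff_of_notMem _ _ hi, ENNReal.ofReal_zero]
    · exact ((measurable_logCutoff ρ _).comp (measurable_norm.comp
        (B.ends i).measurable_trans)).ennreal_ofReal.pow_const 2
  · have hlim := tendsto_finsetSum Finset.univ fun i _ =>
      (B.ends i).tendsto_lintegral_gradBound_sq hp hd rfl B.isWeightedVolume_vol (hM i) (hρ i)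
    rw [Finset.sum_const_zero] at hlim
    refine tendsto_of_tendsto_of_tendsto_of_le_of_le tendsto_const_nhds hlim (fun _ => zero_le)
      fun k => ?_
    simp only
    rw [B.lintegral_eq, ← lintegral_finsetSum _ fun i _ => ?_]
    · refine lintegral_mono fun x => ?_
      rw [← B.sq_sum_eq (x := x) fun i hi => ?_]
      · gcongr
        exact B.metricSlope_tipCutoff_le hρ (by positivity) x
      · rw [(B.ends i).trans_of_notMem hi, norm_zero, DpEnd.gradBound, if_neg]
        · simp
        · simp [hρ0, Real.exp_pos]
    · exact ((((B.ends i).measurable_gradBound ρ _).comp (measurable_norm.comp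
        (B.ends i).measurable_trans)).const_mul 2).ennreal_ofReal.pow_const 2

end AsymptoticallyDpBrane

end

theorem proposition3p10 (X : Type u) [MetricSpace X] [CompleteSpace X]
    [TopologicalSpace.SeparableSpace X] [MeasurableSpace X] [BorelSpace X]
    (m : Measure X) [SigmaFinite m] (p d : ℕ) (hp : p ≤ 7) (hd : d ≤ p + 1)
    (B : AsymptoticallyDpBrane X m p d)
    (hfin : p = 6 ∨ p = 7 → ∀ i, (B.ends i).M.HasFiniteVolume) :
    IsPolar m (singularSet m) := by
  by_cases h5 : p ≤ 5
  · exact B.isPolar_singularSet_of_tips_eq_empty (B.tips_eq_empty h5)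
  · have h67 : p = 6 ∨ p = 7 := by omega
    exact B.isPolar_singularSet_of_finite_volume h67 hd (hfin h67)
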